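/- A lattice is a discrete additive subgroup of $\mathbb C$ of rank $2$. For a lattice $\Gamma$ let $$\wp(z;\Gamma)=\frac1{z^2}+\sum_{u\in\Gamma\setminus\{0\}}\Bigl(\frac1{(z-u)^2}-\frac1{u^2}\Bigr),\quad g_2(\Gamma)=\sum_{u\in\Gamma\setminus\{0\}}\frac{60}{u^4},\quad g_3(\Gamma)=\sum_{u\in\Gamma\setminus\{0\}}\frac{140}{u^6}.$$ A reduced basis of $\Gamma$ is a pair $\omega_1,\omega_2$ such that $\omega_1\in\Gamma\setminus\{0\}$ has the minimal absolute value among the elements of $\Gamma\setminus\{0\}$, and $\omega_2\in\Gamma\setminus\omega_1\mathbb Z$ has the minimal absolute value among the elements of $\Gamma\setminus\omega_1\mathbb Z$. A triple $(e_1,e_2,e_3)$ of complex numbers is properly ordered if $|e_2-e_3|\le|e_1-e_3|\le|e_1-e_2|$. The Landen map $\mathscr L$ sends a complex number $e_1$ and an unordered pair $\{e_2,e_3\}$ of complex numbers to the unique $(f_1,\{f_2,f_3\})$ with $$f_1=-\frac{e_1}2,\quad f_1+f_2+f_3=0,\quad 16(f_2-f_1)(f_3-f_1)=(e_2-e_3)^2.$$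 **Lemma l41.** Let $\Gamma$ be a lattice and let $(e_1,e_2,e_3)$ be a properly ordered triple of the roots of $4x^3-g_2(\Gamma)x-g_3(\Gamma)$. Let $\omega_1,\omega_2$ be a reduced basis of $\Gamma$ such that $e_1=\wp(\omega_1/2;\Gamma)$, $e_2=\wp(\omega_2/2;\Gamma)$ and $e_3=\wp((\omega_1+\omega_2)/2;\Gamma)$. Let $(f_1,\{f_2,f_3\})=\mathscr L(e_2,\{e_1,e_3\})$, and let $\hat\Gamma$ be the additive subgroup of $\mathbb C$ generated by $\omega_2$ and $2\omega_1$. Then: (i) $\hat\Gamma$ is a lattice and a subgroup of $\Gamma$ of index $2$; the roots of $4x^3-g_2(\hat\Gamma)x-g_3(\hat\Gamma)$, counted with multiplicity, are $f_1,f_2,f_3$; and $f_1=\wp(\omega_1;\hat\Gamma)$. (ii) At least one of $\omega_2$ and $2\omega_1$ is an element of $\hat\Gamma\setminus\{0\}$ of minimal absolute value. If $2\omega_1$ is such an element, then $(2\omega_1,\omega_2)$ is a reduced basis of $\hat\Gamma$. If $\omega_2$ is such an element, then at least one of $(\omega_2,2\omega_1)$, $(\omega_2,2\omega_1+\omega_2)$,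 $(\omega_2,2\omega_1-\omega_2)$ is a reduced basis of $\hat\Gamma$. (iii) $2|\omega_1|\le|\omega_2|$ if and only if $|f_1-f_2|\ge|f_2-f_3|$ and $|f_1-f_3|\ge|f_2-f_3|$. -/

import Mathlib

namespace LandenWeierstrass

/-- The Weierstrass function `℘(z; Γ)` of an additive subgroup `Γ` of `ℂ`. By the convention
`1 / 0 = 0`, the term `l = 0` of the sum is `1 / z ^ 2`. -/
noncomputable def wp (Γ : Submodule ℤ ℂ) (z : ℂ) : ℂ :=
  ∑' l : Γ, (1 / (z - (l : ℂ)) ^ 2 - 1 / (l : ℂ) ^ 2)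

/-- The sum of `l⁻ⁿ` over `l ∈ Γ \ {0}` (for `n ≥ 1` the term `l = 0` vanishes, as `0⁻¹ = 0`). -/
noncomputable def eisensteinSum (Γ : Submodule ℤ ℂ) (n : ℕ) : ℂ := ∑' l : Γ, ((l : ℂ) ^ n)⁻¹

/-- The invariant `g₂(Γ)`. -/
noncomputable def g₂ (Γ : Submodule ℤ ℂ) : ℂ := 60 * eisensteinSum Γ 4

/-- The invariant `g₃(Γ)`. -/
noncomputable def g₃ (Γ : Submodule ℤ ℂ) : ℂ := 140 * eisensteinSum Γ 6

/-- These are the functions and invariants that Mathlib attaches to a pair of periods. -/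
theorem wp_lattice (L : PeriodPair) : wp L.lattice = L.weierstrassP := rfl

theorem g₂_lattice (L : PeriodPair) : g₂ L.lattice = L.g₂ := rfl

theorem g₃_lattice (L : PeriodPair) : g₃ L.lattice = L.g₃ := rfl

/-- The polynomial `4 x ^ 3 - g₂(Γ) x - g₃(Γ)`. -/
noncomputable def cubic (Γ : Submodule ℤ ℂ) : Polynomial ℂ :=
  Polynomial.C 4 * Polynomial.X ^ 3 - Polynomial.C (g₂ Γ) * Polynomial.X - Polynomial.C (g₃ Γ)

/-- `ω` is an element of `S` of minimal absolute value. -/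
def IsShortest (S : Set ℂ) (ω : ℂ) : Prop := ω ∈ S ∧ ∀ w ∈ S, ‖ω‖ ≤ ‖w‖

/-- `ω₁, ω₂` is a reduced basis of `Γ`: `ω₁` is shortest in `Γ \ {0}` and `ω₂` is shortest in
`Γ \ ω₁ℤ`. -/
def IsReducedBasis (Γ : Submodule ℤ ℂ) (ω₁ ω₂ : ℂ) : Prop :=
  IsShortest ((Γ : Set ℂ) \ {0}) ω₁ ∧
  IsShortest ((Γ : Set ℂ) \ (Submodule.span ℤ {ω₁} : Submodule ℤ ℂ)) ω₂

/-- A properly ordered triple of complex numbers. -/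
def ProperlyOrdered (e₁ e₂ e₃ : ℂ) : Prop :=
  ‖e₂ - e₃‖ ≤ ‖e₁ - e₃‖ ∧ ‖e₁ - e₃‖ ≤ ‖e₁ - e₂‖

/-- The Landen map `(e₁, {e₂, e₃}) ↦ (f₁, {f₂, f₃})` on a complex number together with an unordered
pair of complex numbers. Explicitly `f₁ = - e₁ / 2` and `{f₂, f₃} = {e₁ / 4 + r, e₁ / 4 - r}` with
`16 r ^ 2 = 9 e₁ ^ 2 - (e₂ - e₃) ^ 2`; see `landen_eq_iff` for its characterization. -/
noncomputable def landen (e : ℂ × Sym2 ℂ) : ℂ × Sym2 ℂ :=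
  (-e.1 / 2, Sym2.lift ⟨fun e₂ e₃ =>
    s(e.1 / 4 + ((9 * e.1 ^ 2 - (e₂ - e₃) ^ 2) ^ (1 / 2 : ℂ)) / 4,
      e.1 / 4 - ((9 * e.1 ^ 2 - (e₂ - e₃) ^ 2) ^ (1 / 2 : ℂ)) / 4), by
    intro a b
    beta_reduce
    rw [show (a - b) ^ 2 = (b - a) ^ 2 by ring]⟩ e.2)

/-- The conditions that define the Landen map. -/
theorem landen_eq_iff (e₁ e₂ e₃ f₁ f₂ f₃ : ℂ) :
    landen (e₁, s(e₂, e₃)) = (f₁, s(f₂, f₃)) ↔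
      f₁ = -e₁ / 2 ∧ f₁ + f₂ + f₃ = 0 ∧ 16 * (f₂ - f₁) * (f₃ - f₁) = (e₂ - e₃) ^ 2 := by
  have hr : ((9 * e₁ ^ 2 - (e₂ - e₃) ^ 2) ^ (1 / 2 : ℂ)) ^ 2 = 9 * e₁ ^ 2 - (e₂ - e₃) ^ 2 := by
    rw [← Complex.cpow_nat_mul]
    norm_num
  simp only [landen, Sym2.lift_mk, Prod.mk.injEq, Sym2.eq_iff]
  generalize (9 * e₁ ^ 2 - (e₂ - e₃) ^ 2) ^ (1 / 2 : ℂ) = r at hr ⊢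
  constructor
  · rintro ⟨rfl, ⟨rfl, rfl⟩ | ⟨rfl, rfl⟩⟩
    · exact ⟨rfl, by ring, by linear_combination -hr⟩
    · exact ⟨rfl, by ring, by linear_combination -hr⟩
  · rintro ⟨rfl, h1, h2⟩
    refine ⟨rfl, ?_⟩
    have h3 : f₃ = e₁ / 2 - f₂ := by linear_combination h1
    subst h3
    have h4 : (f₂ - (e₁ / 4 + r / 4)) * (f₂ - (e₁ / 4 - r / 4)) = 0 := by
      linear_combination (-1 / 16 : ℂ) * h2 - (1 / 16 : ℂ) * hr
    rcases mul_eq_zero.mp h4 with h | h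
    · left
      exact ⟨by linear_combination -h, by linear_combination h⟩
    · right
      exact ⟨by linear_combination h, by linear_combination -h⟩

end LandenWeierstrass

namespace LandenWeierstrass

/-! ### Reduced bases -/

section ReducedBasis

variable {Γ : Submodule ℤ ℂ} {ω₁ ω₂ : ℂ}

/-! Part (ii) is geometry of numbers. With `τ = ω₂ / ω₁`, reducedness gives `|τ| ≥ 1` and `|Re τ| ≤
1/2`, the pair generates `Γ`, and every claim about shortest vectors concerns the form `|a + b τ|²`
with `a` even (`exists_min_form`).

Part (i) rests on two facts about `℘`. For a half period `ω`, the product `(℘ z - ℘ ω) (℘ (z - ω) -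
℘ ω)` has only removable singularities, so it is constant (`exists_weierstrassP_mul_eq`), and it is
nonzero. Nonvanishing makes the three half period values distinct, hence they are the roots of the
cubic. Splitting `Γ` into two cosets of `Γ'` writes `℘` of `Γ` as a sum of two translates of `℘` of
`Γ'` up to a constant. The constancy of the product, evaluated at a quarter period and at a half
period, is then exactly the Landen relation (`landen_weierstrassP`).

Part (iii) compares half period values for `Γ'` with periods `2 ω₁, ω₂`; now `τ` is their ratio and
`q = exp (π i τ)`. Up to a common factor, the differences "right minus sum" and "left minus sum"
have absolute values `16 |N(q)|` and `|U(q)|`, where `N` is `nSeries` (close to 1) and `U` is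
`uSeries`, that is `1/q - 8` plus a small error. On `|τ| = 1` the two are equal, by complex
conjugation. Moving outward along a ray near the imaginary axis strictly increases `|U| / |N|`
(`norm_uSeries_mul_nSeries_lt`); for large `Im τ` crude bounds suffice. So `|τ| ≥ 1` gives the
required inequalities. If `|τ| < 1`, exchanging the periods gives a ratio of absolute value above 1
and the reverse strict inequality; that this ratio lies in the region covered is
`IsReducedBasis.re_le_or_le_im`. -/

lemma sq_norm_real_combination (h : ω₁ ≠ 0) (a b : ℝ) :
    ‖a * ω₁ + b * ω₂‖ ^ 2 =
      ‖ω₁‖ ^ 2 * (a ^ 2 + 2 * a * b * (ω₂ / ω₁).re + b ^ 2 * ‖ω₂ / ω₁‖ ^ 2) := by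
  have h1 : a * ω₁ + b * ω₂ = ω₁ * (a + b * (ω₂ / ω₁)) := by field_simp
  rw [h1, norm_mul, mul_pow]
  congr 1
  generalize ω₂ / ω₁ = τ
  rw [Complex.sq_norm, Complex.sq_norm, Complex.normSq_apply, Complex.normSq_apply]
  simp
  ring

lemma sq_norm_int_combination (h : ω₁ ≠ 0) (a b : ℤ) :
    ‖a * ω₁ + b * ω₂‖ ^ 2 =
      ‖ω₁‖ ^ 2 * (a ^ 2 + 2 * a * b * (ω₂ / ω₁).re + b ^ 2 * ‖ω₂ / ω₁‖ ^ 2) := by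
  simpa using sq_norm_real_combination (ω₂ := ω₂) h a b

lemma sq_norm_right (h : ω₁ ≠ 0) : ‖ω₂‖ ^ 2 = ‖ω₁‖ ^ 2 * ‖ω₂ / ω₁‖ ^ 2 := by
  rw [← mul_pow, ← norm_mul, mul_div_cancel₀ _ h]

lemma linearIndependent_of_im_ne_zero (h : ω₁ ≠ 0) (him : (ω₂ / ω₁).im ≠ 0) :
    LinearIndependent ℝ ![ω₁, ω₂] := by
  rw [LinearIndependent.pair_iff]
  intro s t hst
  simp only [Complex.real_smul] at hst
  have h1 : (s + t * (ω₂ / ω₁) : ℂ) = 0 := by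
    field_simp
    linear_combination hst
  have h2 : t = 0 := by
    have := congrArg Complex.im h1
    simpa [him] using this
  refine ⟨?_, h2⟩
  simpa [h2] using h1

lemma IsReducedBasis.ne_zero (h : IsReducedBasis Γ ω₁ ω₂) : ω₁ ≠ 0 := by
  simpa using h.1.1.2

lemma IsReducedBasis.mem_left (h : IsReducedBasis Γ ω₁ ω₂) : ω₁ ∈ Γ := h.1.1.1

lemma IsReducedBasis.mem_right (h : IsReducedBasis Γ ω₁ ω₂) : ω₂ ∈ Γ := h.2.1.1

lemma IsReducedBasis.ne_intCast_mul (h : IsReducedBasis Γ ω₁ ω₂) (k : ℤ) : ω₂ ≠ k * ω₁ := by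
  intro hk
  refine h.2.1.2 (Submodule.mem_span_singleton.mpr ⟨k, ?_⟩)
  rw [hk, zsmul_eq_mul]

lemma IsReducedBasis.norm_le_of_ne (h : IsReducedBasis Γ ω₁ ω₂) {w : ℂ} (hw : w ∈ Γ)
    (hne : ∀ k : ℤ, w ≠ k * ω₁) : ‖ω₂‖ ≤ ‖w‖ := by
  refine h.2.2 w ⟨hw, fun hmem => ?_⟩
  obtain ⟨k, hk⟩ := Submodule.mem_span_singleton.mp hmem
  exact hne k (by rw [← hk, zsmul_eq_mul])

lemma IsReducedBasis.int_combination_mem (h : IsReducedBasis Γ ω₁ ω₂) (a b : ℤ) :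
    a * ω₁ + b * ω₂ ∈ Γ := by
  simpa using add_mem (Γ.smul_mem a h.mem_left) (Γ.smul_mem b h.mem_right)

lemma IsReducedBasis.right_ne_zero (h : IsReducedBasis Γ ω₁ ω₂) : ω₂ ≠ 0 := by
  simpa using h.ne_intCast_mul 0

lemma IsReducedBasis.norm_le (h : IsReducedBasis Γ ω₁ ω₂) : ‖ω₁‖ ≤ ‖ω₂‖ :=
  h.1.2 ω₂ ⟨h.mem_right, by simpa using h.right_ne_zero⟩

lemma IsReducedBasis.one_le_norm_div (h : IsReducedBasis Γ ω₁ ω₂) : 1 ≤ ‖ω₂ / ω₁‖ := by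
  rw [norm_div, one_le_div (norm_pos_iff.mpr h.ne_zero)]
  exact h.norm_le

lemma IsReducedBasis.abs_re_le (h : IsReducedBasis Γ ω₁ ω₂) : |(ω₂ / ω₁).re| ≤ 1 / 2 := by
  have hpos : 0 < ‖ω₁‖ ^ 2 := by have := norm_pos_iff.mpr h.ne_zero; positivity
  -- Minimality of `ω₂` against `ω₂ + ω₁` and `ω₂ - ω₁` bounds the real part from both sides.
  have key : ∀ a : ℤ, a ^ 2 = 1 → 0 ≤ 1 + 2 * a * (ω₂ / ω₁).re := by
    intro a ha
    have h1 : ‖ω₂‖ ≤ ‖a * ω₁ + (1 : ℤ) * ω₂‖ := by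
      refine h.norm_le_of_ne (h.int_combination_mem a 1) fun k hk => ?_
      refine h.ne_intCast_mul (k - a) ?_
      push_cast at hk ⊢
      linear_combination hk
    have h2 := pow_le_pow_left₀ (norm_nonneg _) h1 2
    rw [sq_norm_int_combination h.ne_zero, sq_norm_right h.ne_zero,
      mul_le_mul_iff_right₀ hpos] at h2
    have h3 : (a : ℝ) ^ 2 = 1 := by exact_mod_cast ha
    push_cast at h2
    linarith
  have h1 := key 1 (by norm_num)
  have h2 := key (-1) (by norm_num)
  push_cast at h1 h2
  rw [abs_le]
  constructor <;> linarith

lemma IsReducedBasis.im_ne_zero (h : IsReducedBasis Γ ω₁ ω₂) : (ω₂ / ω₁).im ≠ 0 := by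
  intro him
  have h1 : ((ω₂ / ω₁).re : ℂ) = ω₂ / ω₁ := by
    apply Complex.ext <;> simp [him]
  have h2 := h.abs_re_le
  have h3 := h.one_le_norm_div
  rw [← h1, Complex.norm_real, Real.norm_eq_abs] at h3
  linarith

lemma IsReducedBasis.linearIndependent (h : IsReducedBasis Γ ω₁ ω₂) :
    LinearIndependent ℝ ![ω₁, ω₂] :=
  linearIndependent_of_im_ne_zero h.ne_zero h.im_ne_zero

/-- A reduced basis generates the lattice. -/
lemma IsReducedBasis.exists_int_combination (h : IsReducedBasis Γ ω₁ ω₂) {z : ℂ} (hz : z ∈ Γ) :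
    ∃ a b : ℤ, z = a * ω₁ + b * ω₂ := by
  have h0 := h.ne_zero
  have him := h.im_ne_zero
  set τ := ω₂ / ω₁ with hτ
  obtain ⟨s, t, hst⟩ : ∃ s t : ℝ, z = s * ω₁ + t * ω₂ := by
    refine ⟨(z / ω₁).re - (z / ω₁).im / τ.im * τ.re, (z / ω₁).im / τ.im, ?_⟩
    have h1 : z / ω₁ = ((z / ω₁).re - (z / ω₁).im / τ.im * τ.re : ℝ) +
        ((z / ω₁).im / τ.im : ℝ) * τ := by
      apply Complex.ext
      · simp
      · simp [him]
    have h2 : ω₂ = τ * ω₁ := by rw [hτ]; field_simp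
    calc z = z / ω₁ * ω₁ := by field_simp
      _ = _ := congrArg (· * ω₁) h1
      _ = _ := by rw [h2]; ring
  -- Rounding the real coordinates leaves a remainder with coefficients at most 1/2 in absolute
  -- value. With `T = |τ|² ≥ 1`, its squared norm in units of `|ω₁|²` is at most `1/2 + T/4 < T`, so
  -- it is shorter than `ω₂` and must lie in `ω₁ℤ`.
  set w : ℂ := ((s - round s : ℝ) : ℂ) * ω₁ + ((t - round t : ℝ) : ℂ) * ω₂ with hw
  have hwz : w = z - (round s * ω₁ + round t * ω₂) := by
    rw [hw, hst]; push_cast; ring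
  have hwΓ : w ∈ Γ := hwz ▸ sub_mem hz (h.int_combination_mem _ _)
  by_cases hc : ∃ k : ℤ, w = k * ω₁
  · obtain ⟨k, hk⟩ := hc
    refine ⟨k + round s, round t, ?_⟩
    push_cast
    linear_combination hk - hwz
  · exfalso
    push Not at hc
    have h1 := pow_le_pow_left₀ (norm_nonneg _) (h.norm_le_of_ne hwΓ hc) 2
    have hpos : 0 < ‖ω₁‖ ^ 2 := by have := norm_pos_iff.mpr h.ne_zero; positivity
    rw [hw, sq_norm_real_combination h0, sq_norm_right h0, mul_le_mul_iff_right₀ hpos] at h1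
    have hs := abs_sub_round s
    have ht := abs_sub_round t
    have hx := h.abs_re_le
    have hT := h.one_le_norm_div
    rw [← hτ] at hx hT h1
    set a := s - round s
    set b := t - round t
    have ha : a ^ 2 ≤ 1 / 4 := by rw [← sq_abs]; nlinarith [abs_nonneg a]
    have hb : b ^ 2 ≤ 1 / 4 := by rw [← sq_abs]; nlinarith [abs_nonneg b]
    have hab : |a * b * τ.re| ≤ 1 / 8 := by
      rw [abs_mul, abs_mul]
      calc |a| * |b| * |τ.re| ≤ 1 / 2 * (1 / 2) * (1 / 2) := by gcongr
        _ = 1 / 8 := by norm_num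
    have hab' := le_abs_self (a * b * τ.re)
    have hT2 : 1 ≤ ‖τ‖ ^ 2 := one_le_pow₀ hT
    nlinarith

lemma IsReducedBasis.mem_iff (h : IsReducedBasis Γ ω₁ ω₂) {z : ℂ} :
    z ∈ Γ ↔ ∃ a b : ℤ, z = a * ω₁ + b * ω₂ :=
  ⟨h.exists_int_combination, by rintro ⟨a, b, rfl⟩; exact h.int_combination_mem a b⟩

lemma IsReducedBasis.norm_le_int_combination (h : IsReducedBasis Γ ω₁ ω₂) (a : ℤ) {b : ℤ}
    (hb : b ≠ 0) : ‖ω₂‖ ≤ ‖a * ω₁ + b * ω₂‖ := by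
  refine h.norm_le_of_ne (h.int_combination_mem a b) fun k hk => hb ?_
  have h1 := (LinearIndependent.pair_iff.mp h.linearIndependent) (a - k) b (by
    simp only [Complex.real_smul]
    push_cast
    linear_combination hk)
  exact_mod_cast h1.2

lemma mem_span_double_iff {z : ℂ} :
    z ∈ Submodule.span ℤ ({ω₂, 2 * ω₁} : Set ℂ) ↔
      ∃ n m : ℤ, z = (2 * n : ℤ) * ω₁ + m * ω₂ := by
  rw [Submodule.mem_span_pair]
  constructor
  · rintro ⟨m, n, rfl⟩
    exact ⟨n, m, by simp; ring⟩
  · rintro ⟨n, m, rfl⟩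
    exact ⟨m, n, by simp; ring⟩

lemma IsReducedBasis.int_coeff_unique (h : IsReducedBasis Γ ω₁ ω₂) {a b c d : ℤ}
    (he : (a * ω₁ + b * ω₂ : ℂ) = c * ω₁ + d * ω₂) : a = c ∧ b = d := by
  have h1 := (LinearIndependent.pair_iff.mp h.linearIndependent) (a - c) (b - d) (by
    simp only [Complex.real_smul]
    push_cast
    linear_combination he)
  constructor
  · exact_mod_cast sub_eq_zero.mp h1.1
  · exact_mod_cast sub_eq_zero.mp h1.2

lemma IsReducedBasis.span_double_le (h : IsReducedBasis Γ ω₁ ω₂) :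
    Submodule.span ℤ ({ω₂, 2 * ω₁} : Set ℂ) ≤ Γ := by
  intro z hz
  obtain ⟨n, m, rfl⟩ := mem_span_double_iff.mp hz
  exact h.int_combination_mem _ _

lemma IsReducedBasis.mem_span_double (h : IsReducedBasis Γ ω₁ ω₂) (a b : ℤ) :
    a * ω₁ + b * ω₂ ∈ Submodule.span ℤ ({ω₂, 2 * ω₁} : Set ℂ) ↔ Even a := by
  rw [mem_span_double_iff]
  constructor
  · rintro ⟨n, m, hnm⟩
    obtain ⟨rfl, -⟩ := h.int_coeff_unique hnm
    exact even_two_mul n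
  · rintro ⟨n, rfl⟩
    exact ⟨n, b, by push_cast; ring⟩

lemma IsReducedBasis.relIndex_span_double (h : IsReducedBasis Γ ω₁ ω₂) :
    (Submodule.span ℤ ({ω₂, 2 * ω₁} : Set ℂ)).toAddSubgroup.relIndex Γ.toAddSubgroup = 2 := by
  rw [AddSubgroup.relIndex_eq_two_iff]
  refine ⟨ω₁, h.mem_left, fun z hz => ?_⟩
  obtain ⟨a, b, rfl⟩ := h.exists_int_combination hz
  have h1 := h.mem_span_double a b
  have h2 := h.mem_span_double (a + 1) b
  rw [show ((a + 1 : ℤ) : ℂ) * ω₁ + b * ω₂ = a * ω₁ + b * ω₂ + ω₁ by push_cast; ring] at h2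
  simp only [Submodule.mem_toAddSubgroup, h1, h2]
  by_cases ha : Even a
  · exact Or.inr ⟨ha, by simpa [Int.even_add_one] using ha⟩
  · exact Or.inl ⟨Int.even_add_one.mpr ha, ha⟩

lemma IsReducedBasis.isShortest_span_double (h : IsReducedBasis Γ ω₁ ω₂) :
    IsShortest ((Submodule.span ℤ ({ω₂, 2 * ω₁} : Set ℂ) : Set ℂ) \ {0}) ω₂ ∨
      IsShortest ((Submodule.span ℤ ({ω₂, 2 * ω₁} : Set ℂ) : Set ℂ) \ {0}) (2 * ω₁) := by
  have m1 : ω₂ ∈ (Submodule.span ℤ ({ω₂, 2 * ω₁} : Set ℂ) : Set ℂ) \ {0} :=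
    ⟨Submodule.subset_span (by simp), by simpa using h.right_ne_zero⟩
  have m2 : 2 * ω₁ ∈ (Submodule.span ℤ ({ω₂, 2 * ω₁} : Set ℂ) : Set ℂ) \ {0} :=
    ⟨Submodule.subset_span (by simp), by simpa using h.ne_zero⟩
  -- A vector with nonzero `ω₂`-coefficient is at least as long as `ω₂`; the others are multiples of
  -- `2 ω₁`.
  have key : ∀ w ∈ (Submodule.span ℤ ({ω₂, 2 * ω₁} : Set ℂ) : Set ℂ) \ {0},
      ‖ω₂‖ ≤ ‖w‖ ∨ ‖2 * ω₁‖ ≤ ‖w‖ := by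
    rintro w ⟨hw, hw0⟩
    obtain ⟨n, m, rfl⟩ := mem_span_double_iff.mp hw
    by_cases hm : m = 0
    · right
      subst hm
      have hn : n ≠ 0 := by rintro rfl; simp at hw0
      have hn1 : (1 : ℝ) ≤ |(n : ℝ)| := by exact_mod_cast Int.one_le_abs hn
      have h1 : ‖((2 * n : ℤ) : ℂ) * ω₁ + (0 : ℤ) * ω₂‖ = |(n : ℝ)| * ‖2 * ω₁‖ := by
        rw [← Complex.norm_intCast, ← norm_mul]
        congr 1
        push_cast
        ring
      rw [h1]
      nlinarith [norm_nonneg (2 * ω₁)]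
    · exact Or.inl (h.norm_le_int_combination _ hm)
  rcases le_total ‖ω₂‖ ‖2 * ω₁‖ with hle | hle
  · exact Or.inl ⟨m1, fun w hw => (key w hw).elim id hle.trans⟩
  · exact Or.inr ⟨m2, fun w hw => (key w hw).elim hle.trans id⟩

lemma IsReducedBasis.isReducedBasis_double_left (h : IsReducedBasis Γ ω₁ ω₂)
    (hs : IsShortest ((Submodule.span ℤ ({ω₂, 2 * ω₁} : Set ℂ) : Set ℂ) \ {0}) (2 * ω₁)) :
    IsReducedBasis (Submodule.span ℤ {ω₂, 2 * ω₁}) (2 * ω₁) ω₂ := by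
  refine ⟨hs, ⟨Submodule.subset_span (by simp), fun hmem => ?_⟩, ?_⟩
  · obtain ⟨k, hk⟩ := Submodule.mem_span_singleton.mp hmem
    refine h.ne_intCast_mul (k * 2) ?_
    rw [← hk, zsmul_eq_mul]
    push_cast
    ring
  · rintro w ⟨hw, hw'⟩
    obtain ⟨n, m, rfl⟩ := mem_span_double_iff.mp hw
    refine h.norm_le_int_combination _ ?_
    rintro rfl
    refine hw' (Submodule.mem_span_singleton.mpr ⟨n, ?_⟩)
    rw [zsmul_eq_mul]
    push_cast
    ring

/-- The quadratic form `4 n² + 2 n m X + m² T`, the squared norm of `2 n + m τ` with `X = 2 Re τ`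
and `T = |τ|²`, is minimal over `n ≠ 0` at `n = 1` and some `m ∈ {0, 1, -1}`. -/
lemma exists_min_form {X T : ℝ} (hX : |X| ≤ 1) (hT : 1 ≤ T) :
    ∃ k : ℤ, (k = 0 ∨ k = 1 ∨ k = -1) ∧ ∀ n m : ℤ, n ≠ 0 →
      4 + 2 * k * X + k ^ 2 * T ≤ 4 * (n : ℝ) ^ 2 + 2 * n * m * X + m ^ 2 * T := by
  have hform : ∀ n m : ℤ, 4 * |(n : ℝ)| ^ 2 - 2 * |(n : ℝ)| * |(m : ℝ)| * |X| + |(m : ℝ)| ^ 2 * T ≤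
      4 * (n : ℝ) ^ 2 + 2 * n * m * X + m ^ 2 * T := by
    intro n m
    rw [sq_abs, sq_abs]
    have h1 := neg_abs_le ((n : ℝ) * m * X)
    rw [abs_mul, abs_mul] at h1
    linarith
  have hlarge : ∀ a b : ℝ, 2 ≤ a → 0 ≤ b → 4 ≤ 4 * a ^ 2 - 2 * a * b * |X| + b ^ 2 * T := by
    intro a b ha hb
    have h1 : a * b * |X| ≤ a * b * 1 := by gcongr
    have h2 : b ^ 2 * 1 ≤ b ^ 2 * T := by gcongr
    nlinarith [sq_nonneg (a - b)]
  have hn : ∀ n : ℤ, n ≠ 0 → |(n : ℝ)| = 1 ∨ 2 ≤ |(n : ℝ)| := by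
    intro n hn
    have h1 := Int.one_le_abs hn
    rcases h1.eq_or_lt with h | h
    · left; exact_mod_cast h.symm
    · right; exact_mod_cast h
  have hm : ∀ m : ℤ, |(m : ℝ)| = 0 ∨ 1 ≤ |(m : ℝ)| := by
    intro m
    by_cases h : m = 0
    · left; simp [h]
    · right; exact_mod_cast Int.one_le_abs h
  -- For `n = 1` the best `m` is 0 when `|X| ≤ T / 2`. Otherwise `m` is the sign opposite to that of
  -- `X`. Values `|n| ≥ 2` never give less than 4, by `hlarge`.
  rcases le_or_gt |X| (T / 2) with hXT | hXT
  · refine ⟨0, Or.inl rfl, fun n m hn0 => ?_⟩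
    refine le_trans ?_ (hform n m)
    simp only [Int.cast_zero, mul_zero, zero_mul, add_zero, ne_eq, OfNat.ofNat_ne_zero,
      not_false_eq_true, zero_pow]
    rcases hn n hn0 with h | h
    · rw [h]
      rcases hm m with h' | h'
      · rw [h']; norm_num
      · have h1 : |(m : ℝ)| * |X| ≤ |(m : ℝ)| * (T / 2) := by gcongr
        have h2 : 0 ≤ |(m : ℝ)| * (|(m : ℝ)| - 1) * T := by
          have : 0 ≤ |(m : ℝ)| - 1 := by linarith
          positivity
        nlinarith
    · exact hlarge _ _ h (abs_nonneg _)
  · obtain ⟨k, hk, hkX⟩ : ∃ k : ℤ, (k = 1 ∨ k = -1) ∧ (k : ℝ) * X = -|X| := by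
      rcases le_total 0 X with h | h
      · exact ⟨-1, Or.inr rfl, by simp [abs_of_nonneg h]⟩
      · exact ⟨1, Or.inl rfl, by simp [abs_of_nonpos h]⟩
    have hk2 : (k : ℝ) ^ 2 = 1 := by
      rcases hk with rfl | rfl <;> norm_num
    refine ⟨k, Or.inr hk, fun n m hn0 => le_trans ?_ (hform n m)⟩
    rw [hk2, mul_assoc, hkX]
    rcases hn n hn0 with h | h
    · rw [h]
      rcases hm m with h' | h'
      · rw [h']; linarith
      · have h2 : 0 ≤ (|(m : ℝ)| - 1) * ((|(m : ℝ)| + 1) * T - 2 * |X|) := by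
          apply mul_nonneg
          · linarith
          · nlinarith
        nlinarith
    · have := hlarge _ _ h (abs_nonneg (m : ℝ))
      linarith

/-- The elements outside `ω₂ℤ` are the `2 n ω₁ + m ω₂` with `n ≠ 0`; division by `ω₁` turns their
squared norms into the form of `exists_min_form`. -/
lemma IsReducedBasis.isReducedBasis_double_right (h : IsReducedBasis Γ ω₁ ω₂)
    (hs : IsShortest ((Submodule.span ℤ ({ω₂, 2 * ω₁} : Set ℂ) : Set ℂ) \ {0}) ω₂) :
    IsReducedBasis (Submodule.span ℤ {ω₂, 2 * ω₁}) ω₂ (2 * ω₁) ∨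
      IsReducedBasis (Submodule.span ℤ {ω₂, 2 * ω₁}) ω₂ (2 * ω₁ + ω₂) ∨
      IsReducedBasis (Submodule.span ℤ {ω₂, 2 * ω₁}) ω₂ (2 * ω₁ - ω₂) := by
  have hX : |2 * (ω₂ / ω₁).re| ≤ 1 := by
    rw [abs_mul, abs_two]
    linarith [h.abs_re_le]
  obtain ⟨k, hk, hmin⟩ := exists_min_form hX (one_le_pow₀ h.one_le_norm_div (n := 2))
  have key : IsReducedBasis (Submodule.span ℤ {ω₂, 2 * ω₁}) ω₂ (2 * ω₁ + k * ω₂) := by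
    refine ⟨hs, ⟨?_, fun hmem => ?_⟩, ?_⟩
    · exact mem_span_double_iff.mpr ⟨1, k, by push_cast; ring⟩
    · obtain ⟨l, hl⟩ := Submodule.mem_span_singleton.mp hmem
      have := (h.int_coeff_unique (a := 0) (b := l) (c := 2) (d := k) (by
        rw [zsmul_eq_mul] at hl
        push_cast
        linear_combination hl)).1
      omega
    · rintro w ⟨hw, hw'⟩
      obtain ⟨n, m, rfl⟩ := mem_span_double_iff.mp hw
      have hn : n ≠ 0 := by
        rintro rfl
        refine hw' (Submodule.mem_span_singleton.mpr ⟨m, ?_⟩)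
        simp
      refine le_of_sq_le_sq ?_ (norm_nonneg _)
      rw [show (2 * ω₁ + k * ω₂ : ℂ) = (2 : ℤ) * ω₁ + k * ω₂ by push_cast; ring,
        sq_norm_int_combination h.ne_zero, sq_norm_int_combination h.ne_zero]
      have := hmin n m hn
      push_cast
      gcongr ?_ * ?_
      linarith
  rcases hk with rfl | rfl | rfl
  · exact Or.inl (by simpa using key)
  · exact Or.inr (Or.inl (by simpa using key))
  · exact Or.inr (Or.inr (by simpa [sub_eq_add_neg] using key))

end ReducedBasis

end LandenWeierstrass

namespace LandenWeierstrass

open Filter Topology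

/-! ### Values of `℘` at half periods -/

section HalfPeriods

lemma analyticAt_comp_sub_const {f : ℂ → ℂ} {c z : ℂ} (h : AnalyticAt ℂ f (z - c)) :
    AnalyticAt ℂ (fun x => f (x - c)) z :=
  AnalyticAt.comp (g := f) (f := fun x => x - c) (x := z) h (by fun_prop)

variable (L : PeriodPair)

variable {L} in
lemma add_mem_lattice_iff {z w : ℂ} (hw : w ∈ L.lattice) : z + w ∈ L.lattice ↔ z ∈ L.lattice :=
  L.lattice.add_mem_iff_left hw

variable {L} in
lemma weierstrassP_add_of_mem (z : ℂ) {w : ℂ} (hw : w ∈ L.lattice) :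
    L.weierstrassP (z + w) = L.weierstrassP z :=
  L.weierstrassP_add_coe z ⟨w, hw⟩

variable {L} in
lemma derivWeierstrassP_half_period {ω : ℂ} (h2 : 2 * ω ∈ L.lattice) :
    L.derivWeierstrassP ω = 0 := by
  have h1 := L.derivWeierstrassP_add_coe (-ω) ⟨2 * ω, h2⟩
  rw [show -ω + 2 * ω = ω by ring, L.derivWeierstrassP_neg] at h1
  linear_combination h1 / 2

lemma weierstrassP_eq_inv_sq_add {z : ℂ} :
    L.weierstrassP z = 1 / z ^ 2 + L.weierstrassPExcept 0 z := by
  have := L.weierstrassPExcept_add 0 z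
  simp at this
  rw [← this]
  simp [add_comm]

lemma eventually_weierstrassP_ne (a : ℂ) : ∀ᶠ z in 𝓝[≠] (0 : ℂ), L.weierstrassP z ≠ a := by
  have h1 : ContinuousAt (fun z => 1 + z ^ 2 * (L.weierstrassPExcept 0 z - a)) 0 := by
    have := (L.analyticAt_weierstrassPExcept 0).continuousAt
    fun_prop
  have h2 := h1.eventually_ne (y := 0) (by simp)
  filter_upwards [mem_nhdsWithin_of_mem_nhds h2, self_mem_nhdsWithin] with z hz hz0 ha
  refine hz ?_
  rw [weierstrassP_eq_inv_sq_add] at ha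
  have hz0' : z ≠ 0 := hz0
  rw [← ha]
  field_simp
  ring

lemma eventually_notMem_lattice : ∀ᶠ z in 𝓝[≠] (0 : ℂ), z ∉ L.lattice := by
  filter_upwards [mem_nhdsWithin_of_mem_nhds (L.compl_lattice_sdiff_singleton_mem_nhds 0),
    self_mem_nhdsWithin] with z hz hz0
  simp_all

variable {L} in
/-- `(℘ z - ℘ ω) (℘ (z - ω) - ℘ ω)` is constant for a half period `ω`. -/
lemma exists_weierstrassP_mul_eq {ω : ℂ} (hω : ω ∉ L.lattice) (h2 : 2 * ω ∈ L.lattice) :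
    ∃ K : ℂ, ∀ z, z ∉ L.lattice → z - ω ∉ L.lattice →
      (L.weierstrassP z - L.weierstrassP ω) * (L.weierstrassP (z - ω) - L.weierstrassP ω) = K := by
  classical
  set a := L.weierstrassP ω
  have hnω : -ω ∉ L.lattice := by simpa using hω
  set g : ℂ → ℂ := fun z => L.weierstrassP (z - ω) - a
  have hP : AnalyticAt ℂ L.weierstrassP (-ω) := L.analyticOnNhd_weierstrassP _ hnω
  have hg : AnalyticAt ℂ g 0 := by
    have h1 : AnalyticAt ℂ (fun z => L.weierstrassP (z - ω)) 0 :=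
      analyticAt_comp_sub_const (by simpa using hP)
    exact h1.sub analyticAt_const
  -- The derivative of `℘` vanishes at a half period, so the second factor has at least a double
  -- zero at 0, which cancels the double pole of the first.
  have hord : ((2 : ℕ) : ℕ∞) ≤ analyticOrderAt g 0 := by
    rw [natCast_le_analyticOrderAt_iff_iteratedDeriv_eq_zero hg]
    intro i hi
    interval_cases i
    · simp [g, a, L.weierstrassP_neg]
    · rw [iteratedDeriv_one]
      simp only [g, deriv_sub_const]
      rw [deriv_comp_sub_const, L.deriv_weierstrassP, zero_sub, L.derivWeierstrassP_neg,
        derivWeierstrassP_half_period h2, neg_zero]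
  obtain ⟨v, hv, hgv⟩ := (natCast_le_analyticOrderAt hg).mp hord
  -- The value `v 0` is the limit at 0. It also serves at the points congruent to `ω`, since
  -- translation by `ω` exchanges the two factors.
  set H : ℂ → ℂ := fun z => if z ∈ L.lattice ∨ z - ω ∈ L.lattice then v 0 else
    (L.weierstrassP z - a) * (L.weierstrassP (z - ω) - a)
  have hper : ∀ z w, w ∈ L.lattice → H (z + w) = H z := by
    intro z w hw
    simp only [H, add_sub_right_comm z w ω, add_mem_lattice_iff hw, weierstrassP_add_of_mem _ hw]
  have hshift : ∀ z, H (z - ω) = H z := by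
    intro z
    have e : z - ω - ω = z + -(2 * ω) := by ring
    have h2' : -(2 * ω) ∈ L.lattice := neg_mem h2
    simp only [H, e, add_mem_lattice_iff h2', weierstrassP_add_of_mem _ h2']
    exact if_congr or_comm rfl (mul_comm _ _)
  have h0 : AnalyticAt ℂ H 0 := by
    have h1 : AnalyticAt ℂ (fun z => (1 + z ^ 2 * (L.weierstrassPExcept 0 z - a)) * v z) 0 := by
      have := L.analyticAt_weierstrassPExcept 0
      fun_prop
    refine h1.congr ?_
    have hcl : ∀ᶠ z in 𝓝 (0 : ℂ), z - ω ∉ L.lattice := by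
      have hc : ContinuousAt (fun z : ℂ => z - ω) 0 := by fun_prop
      exact hc.eventually (L.isClosed_lattice.isOpen_compl.mem_nhds (by simpa using hω))
    filter_upwards [hgv, hcl, L.compl_lattice_sdiff_singleton_mem_nhds 0] with z hz hzω hzL
    by_cases hz0 : z = 0
    · simp [H, hz0]
    · have hzL' : z ∉ L.lattice := by simp_all
      have hz' : L.weierstrassP (z - ω) - a = z ^ 2 * v z := by simpa [g] using hz
      simp only [H, hzL', hzω, or_self, if_false]
      rw [hz', weierstrassP_eq_inv_sq_add]
      field_simp
      ring
  have hlat : ∀ z, z ∈ L.lattice → AnalyticAt ℂ H z := by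
    intro z hz
    have h1 : AnalyticAt ℂ (fun x => H (x - z)) z :=
      analyticAt_comp_sub_const (by simpa using h0)
    have h3 : (fun x => H (x - z)) = H := by
      ext x
      rw [← hper (x - z) z hz, sub_add_cancel]
    rwa [h3] at h1
  have hall : ∀ z, AnalyticAt ℂ H z := by
    intro z
    by_cases hz : z ∈ L.lattice
    · exact hlat z hz
    by_cases hz' : z - ω ∈ L.lattice
    · have h1 : AnalyticAt ℂ (fun x => H (x - ω)) z :=
        analyticAt_comp_sub_const (hlat _ hz')
      rwa [funext hshift] at h1
    · have h1 : AnalyticAt ℂ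
          (fun z => (L.weierstrassP z - a) * (L.weierstrassP (z - ω) - a)) z := by
        have h3 : AnalyticAt ℂ (fun z => L.weierstrassP (z - ω)) z :=
          analyticAt_comp_sub_const (L.analyticOnNhd_weierstrassP _ hz')
        have h4 : AnalyticAt ℂ L.weierstrassP z := L.analyticOnNhd_weierstrassP _ hz
        fun_prop
      refine h1.congr ?_
      have hc : ContinuousAt (fun z : ℂ => z - ω) z := by fun_prop
      filter_upwards [L.isClosed_lattice.isOpen_compl.mem_nhds hz,
        hc.eventually (L.isClosed_lattice.isOpen_compl.mem_nhds hz')] with x hx hx'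
      have hx1 : x ∉ L.lattice := hx
      have hx2 : x - ω ∉ L.lattice := hx'
      simp [H, hx1, hx2]
  have hdiff : Differentiable ℂ H := fun z => (hall z).differentiableAt
  refine ⟨v 0, fun z hz hz' => ?_⟩
  -- Liouville: a continuous function periodic under a lattice has compact range.
  have h3 := hdiff.apply_eq_apply_of_bounded
    (IsZLattice.isCompact_range_of_periodic L.lattice _ hdiff.continuous hper).isBounded z 0
  simpa [H, hz, hz'] using h3

variable {L} in
-- If the constant were 0, then, `℘` being different from `℘ ω` near its pole, the translated factor
-- would vanish near 0. By the identity theorem on the connected complement of the lattice, `℘`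
-- would be constant, contradicting the pole.
lemma weierstrassP_mul_ne_zero {ω : ℂ} (hω : ω ∉ L.lattice) (h2 : 2 * ω ∈ L.lattice) {z : ℂ}
    (hz : z ∉ L.lattice) (hz' : z - ω ∉ L.lattice) :
    (L.weierstrassP z - L.weierstrassP ω) * (L.weierstrassP (z - ω) - L.weierstrassP ω) ≠ 0 := by
  obtain ⟨K, hK⟩ := exists_weierstrassP_mul_eq hω h2
  rw [hK z hz hz']
  rintro rfl
  set a := L.weierstrassP ω
  have hnω : -ω ∉ L.lattice := by simpa using hω
  have h1 : ∀ᶠ z in 𝓝[≠] (0 : ℂ), L.weierstrassP (z - ω) = a := by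
    have hcl : ∀ᶠ z in 𝓝 (0 : ℂ), z - ω ∉ L.lattice := by
      have hc : ContinuousAt (fun z : ℂ => z - ω) 0 := by fun_prop
      exact hc.eventually (L.isClosed_lattice.isOpen_compl.mem_nhds (by simpa using hω))
    filter_upwards [eventually_weierstrassP_ne L a, eventually_notMem_lattice L,
      mem_nhdsWithin_of_mem_nhds hcl] with z hz1 hz2 hz3
    have := hK z hz2 hz3
    rcases mul_eq_zero.mp this with h | h
    · exact absurd (sub_eq_zero.mp h) hz1
    · exact sub_eq_zero.mp h
  have h3 : ∃ᶠ z in 𝓝[≠] (-ω), L.weierstrassP z = a := by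
    have h4 : Tendsto (fun z : ℂ => z + ω) (𝓝[≠] (-ω)) (𝓝[≠] 0) := by
      refine tendsto_nhdsWithin_iff.mpr ⟨?_, ?_⟩
      · have : ContinuousAt (fun z : ℂ => z + ω) (-ω) := by fun_prop
        simpa [ContinuousAt] using this.tendsto.mono_left nhdsWithin_le_nhds
      · filter_upwards [self_mem_nhdsWithin] with z hz
        simpa [add_eq_zero_iff_eq_neg] using hz
    refine Eventually.frequently ?_
    filter_upwards [h4.eventually h1] with z hz
    simpa using hz
  have hcount : (L.lattice : Set ℂ).Countable := by
    rw [← Set.countable_coe_iff]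
    exact L.latticeEquivProd.toEquiv.injective.countable
  have hconn : IsPreconnected ((L.lattice : Set ℂ)ᶜ) :=
    (hcount.isConnected_compl_of_one_lt_rank (by simp)).isPreconnected
  have h5 := L.analyticOnNhd_weierstrassP.eqOn_of_preconnected_of_frequently_eq
    (analyticOnNhd_const (v := a)) hconn (z₀ := -ω) hnω h3
  obtain ⟨z, hz1, hz2⟩ :=
    ((eventually_weierstrassP_ne L a).and (eventually_notMem_lattice L)).exists
  exact hz1 (h5 hz2)

end HalfPeriods

end LandenWeierstrass

namespace LandenWeierstrass

open Polynomial

/-! ### The half period values as the roots of the cubic -/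

section Cubic

variable (L : PeriodPair)

lemma int_combination_div_two_mem_iff (a b : ℤ) :
    (a * L.ω₁ + b * L.ω₂) / 2 ∈ L.lattice ↔ Even a ∧ Even b := by
  rw [PeriodPair.mem_lattice]
  constructor
  · rintro ⟨m, n, hmn⟩
    have h1 := LinearIndependent.pair_iff.mp L.indep (2 * m - a) (2 * n - b) (by
      simp only [Complex.real_smul]
      push_cast
      linear_combination 2 * hmn)
    have h2 : a = 2 * m := by exact_mod_cast (sub_eq_zero.mp h1.1).symm
    have h3 : b = 2 * n := by exact_mod_cast (sub_eq_zero.mp h1.2).symm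
    exact ⟨h2 ▸ even_two_mul m, h3 ▸ even_two_mul n⟩
  · rintro ⟨⟨m, rfl⟩, ⟨n, rfl⟩⟩
    exact ⟨m, n, by push_cast; ring⟩

lemma half_left_notMem : L.ω₁ / 2 ∉ L.lattice := L.ω₁_div_two_notMem_lattice

lemma half_right_notMem : L.ω₂ / 2 ∉ L.lattice := L.ω₂_div_two_notMem_lattice

lemma half_add_notMem : (L.ω₁ + L.ω₂) / 2 ∉ L.lattice := by
  have := int_combination_div_two_mem_iff L 1 1
  simp_all

lemma half_sub_notMem : (L.ω₁ - L.ω₂) / 2 ∉ L.lattice := by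
  have := int_combination_div_two_mem_iff L 1 (-1)
  simp_all [sub_eq_add_neg]

lemma weierstrassP_half_sub :
    L.weierstrassP ((L.ω₁ - L.ω₂) / 2) = L.weierstrassP ((L.ω₁ + L.ω₂) / 2) := by
  rw [show (L.ω₁ + L.ω₂) / 2 = (L.ω₁ - L.ω₂) / 2 + L.ω₂ by ring,
    weierstrassP_add_of_mem _ L.ω₂_mem_lattice]

lemma two_mul_half_mem {z : ℂ} (hz : z ∈ L.lattice) : 2 * (z / 2) ∈ L.lattice := by
  rwa [mul_div_cancel₀ _ two_ne_zero]

lemma weierstrassP_half_neg_sub :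
    L.weierstrassP ((L.ω₂ - L.ω₁) / 2) = L.weierstrassP ((L.ω₁ + L.ω₂) / 2) := by
  rw [← weierstrassP_half_sub, ← L.weierstrassP_neg]
  ring_nf

/-- Translation by `ω₁ / 2` sends `ω₂ / 2` to the third half period modulo the lattice, so one
nonvanishing product gives both inequalities. -/
lemma weierstrassP_half_ne_left :
    L.weierstrassP (L.ω₁ / 2) ≠ L.weierstrassP (L.ω₂ / 2) ∧
      L.weierstrassP (L.ω₁ / 2) ≠ L.weierstrassP ((L.ω₁ + L.ω₂) / 2) := by
  have h1 := weierstrassP_mul_ne_zero (half_left_notMem L) (two_mul_half_mem L L.ω₁_mem_lattice)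
    (half_right_notMem L) (by
      rw [← neg_mem_iff, show -(L.ω₂ / 2 - L.ω₁ / 2) = (L.ω₁ - L.ω₂) / 2 by ring]
      exact half_sub_notMem L)
  rw [show L.ω₂ / 2 - L.ω₁ / 2 = (L.ω₂ - L.ω₁) / 2 by ring, weierstrassP_half_neg_sub] at h1
  obtain ⟨h2, h3⟩ := mul_ne_zero_iff.mp h1
  exact ⟨(sub_ne_zero.mp h2).symm, (sub_ne_zero.mp h3).symm⟩

lemma weierstrassP_half_ne_right :
    L.weierstrassP (L.ω₂ / 2) ≠ L.weierstrassP ((L.ω₁ + L.ω₂) / 2) := by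
  have h1 := weierstrassP_mul_ne_zero (half_right_notMem L) (two_mul_half_mem L L.ω₂_mem_lattice)
    (half_left_notMem L) (by
      rw [show L.ω₁ / 2 - L.ω₂ / 2 = (L.ω₁ - L.ω₂) / 2 by ring]
      exact half_sub_notMem L)
  rw [show L.ω₁ / 2 - L.ω₂ / 2 = (L.ω₁ - L.ω₂) / 2 by ring, weierstrassP_half_sub] at h1
  exact (sub_ne_zero.mp (mul_ne_zero_iff.mp h1).2).symm

variable {L} in
lemma cubic_eq_zero_of_half_period {ω : ℂ} (hω : ω ∉ L.lattice) (h2 : 2 * ω ∈ L.lattice) :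
    4 * L.weierstrassP ω ^ 3 - g₂ L.lattice * L.weierstrassP ω - g₃ L.lattice = 0 := by
  rw [g₂_lattice, g₃_lattice, ← L.derivWeierstrassP_sq ω hω, derivWeierstrassP_half_period h2]
  simp

lemma cubic_half_left : 4 * L.weierstrassP (L.ω₁ / 2) ^ 3 -
    g₂ L.lattice * L.weierstrassP (L.ω₁ / 2) - g₃ L.lattice = 0 :=
  cubic_eq_zero_of_half_period (half_left_notMem L) (two_mul_half_mem L L.ω₁_mem_lattice)

lemma cubic_half_right : 4 * L.weierstrassP (L.ω₂ / 2) ^ 3 -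
    g₂ L.lattice * L.weierstrassP (L.ω₂ / 2) - g₃ L.lattice = 0 :=
  cubic_eq_zero_of_half_period (half_right_notMem L) (two_mul_half_mem L L.ω₂_mem_lattice)

lemma cubic_half_add : 4 * L.weierstrassP ((L.ω₁ + L.ω₂) / 2) ^ 3 -
    g₂ L.lattice * L.weierstrassP ((L.ω₁ + L.ω₂) / 2) - g₃ L.lattice = 0 :=
  cubic_eq_zero_of_half_period (half_add_notMem L)
    (two_mul_half_mem L (add_mem L.ω₁_mem_lattice L.ω₂_mem_lattice))

/-- The values of `℘` at the half periods sum to zero. -/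
lemma weierstrassP_half_sum : L.weierstrassP (L.ω₁ / 2) + L.weierstrassP (L.ω₂ / 2) +
    L.weierstrassP ((L.ω₁ + L.ω₂) / 2) = 0 := by
  obtain ⟨h1, h2⟩ := weierstrassP_half_ne_left L
  have h3 := weierstrassP_half_ne_right L
  have hA := cubic_half_left L
  have hB := cubic_half_right L
  have hC := cubic_half_add L
  generalize L.weierstrassP (L.ω₁ / 2) = A at *
  generalize L.weierstrassP (L.ω₂ / 2) = B at *
  generalize L.weierstrassP ((L.ω₁ + L.ω₂) / 2) = C at *
  -- Subtracting the cubic equations and cancelling differences of distinct roots uses only that the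
  -- cubic has no quadratic term.
  have h4 : 4 * (A ^ 2 + A * B + B ^ 2) - g₂ L.lattice = 0 :=
    mul_left_cancel₀ (sub_ne_zero.mpr h1) (by linear_combination hA - hB)
  have h5 : 4 * (A ^ 2 + A * C + C ^ 2) - g₂ L.lattice = 0 :=
    mul_left_cancel₀ (sub_ne_zero.mpr h2) (by linear_combination hA - hC)
  exact mul_left_cancel₀ (sub_ne_zero.mpr h3) (by linear_combination (h4 - h5) / 4)

/-- The roots of `4 x ^ 3 - g₂ x - g₃` are the values of `℘` at the half periods. -/
lemma roots_cubic_lattice : (cubic L.lattice).roots = {L.weierstrassP (L.ω₁ / 2),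
    L.weierstrassP (L.ω₂ / 2), L.weierstrassP ((L.ω₁ + L.ω₂) / 2)} := by
  obtain ⟨h1, h2⟩ := weierstrassP_half_ne_left L
  have h3 := weierstrassP_half_ne_right L
  have hA := cubic_half_left L
  have hB := cubic_half_right L
  have hC := cubic_half_add L
  have hdeg : (cubic L.lattice).natDegree = 3 := by
    unfold cubic
    compute_degree!
  have hne : cubic L.lattice ≠ 0 := by
    intro h
    simp [h] at hdeg
  have heval : ∀ x, (cubic L.lattice).eval x = 4 * x ^ 3 - g₂ L.lattice * x - g₃ L.lattice := by
    intro x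
    simp [cubic]
  symm
  refine Multiset.eq_of_le_of_card_le ?_ ?_
  · refine (Multiset.le_iff_subset (by simp [h1, h2, h3])).mpr fun x hx => ?_
    rw [mem_roots hne, IsRoot, heval]
    simp only [Multiset.insert_eq_cons, Multiset.mem_cons, Multiset.mem_singleton] at hx
    rcases hx with rfl | rfl | rfl
    · exact hA
    · exact hB
    · exact hC
  · exact (card_roots' _).trans (by simp [hdeg])

end Cubic

/-! ### Sublattices of index two and the Landen relation -/

section Isogeny

/-- If `Λ` is the disjoint union of `M` and `M - ω`, then
`℘_Λ(z) = ℘_M(z) + ℘_M(z + ω) - ℘_M(ω)`. -/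
lemma weierstrassP_eq_add_of_index_two (L M : PeriodPair) {ω : ℂ}
    (hL : ∀ z, z ∈ L.lattice ↔ z ∈ M.lattice ∨ z + ω ∈ M.lattice) (hω : ω ∉ M.lattice) (z : ℂ) :
    L.weierstrassP z = M.weierstrassP z + M.weierstrassP (z + ω) - M.weierstrassP ω := by
  have h1 := M.hasSum_weierstrassP z
  have h2 := (M.hasSum_weierstrassP (z + ω)).sub (M.hasSum_weierstrassP ω)
  set f : ℂ → ℂ := fun l => 1 / (z - l) ^ 2 - 1 / l ^ 2 with hf
  have h1' : HasSum (Set.indicator (M.lattice : Set ℂ) f) (M.weierstrassP z) :=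
    hasSum_subtype_iff_indicator.mp h1
  -- The term at `l` of `℘_M(z + ω) - ℘_M(ω)` is the term at `l - ω` of the series for `℘_L(z)`, so
  -- this difference sums over the second coset.
  have h2' : HasSum (Set.indicator (M.lattice : Set ℂ) (fun l => f (l - ω)))
      (M.weierstrassP (z + ω) - M.weierstrassP ω) := by
    refine hasSum_subtype_iff_indicator.mp (h2.congr_fun fun l => ?_)
    simp only [hf, Function.comp_apply]
    rw [show (z + ω - (l : ℂ)) = z - (l - ω) by ring,
      show ((l : ℂ) - ω) ^ 2 = (ω - l) ^ 2 by ring]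
    ring
  have h3 := (Equiv.hasSum_iff (Equiv.addRight ω)).mpr h2'
  have h4 := h1'.add h3
  have h5 : HasSum (Set.indicator (L.lattice : Set ℂ) f) (L.weierstrassP z) :=
    hasSum_subtype_iff_indicator.mp (L.hasSum_weierstrassP z)
  have h6 := h5.unique (h4.congr_fun fun x => ?_)
  · rw [h6]; ring
  · have hx := hL x
    by_cases hx1 : x ∈ M.lattice
    · have hx2 : x + ω ∉ M.lattice := by rwa [M.lattice.add_mem_iff_right hx1]
      simp_all [Set.indicator]
    · by_cases hx2 : x + ω ∈ M.lattice <;> simp_all [Set.indicator]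

/-- The Landen relations between the values of `℘` at the half periods of the lattice `L` and of
its sublattice `M` of index two. -/
lemma landen_weierstrassP (L M : PeriodPair) (h1 : M.ω₁ = 2 * L.ω₁) (h2 : M.ω₂ = L.ω₂) :
    landen (L.weierstrassP (L.ω₂ / 2),
      s(L.weierstrassP (L.ω₁ / 2), L.weierstrassP ((L.ω₁ + L.ω₂) / 2))) =
    (M.weierstrassP (M.ω₁ / 2), s(M.weierstrassP (M.ω₂ / 2),
      M.weierstrassP ((M.ω₁ + M.ω₂) / 2))) := by
  have hω : M.ω₁ / 2 = L.ω₁ := by rw [h1]; ring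
  have hmem : ∀ z, z ∈ L.lattice ↔ z ∈ M.lattice ∨ z + M.ω₁ / 2 ∈ M.lattice := by
    intro z
    rw [hω]
    simp only [PeriodPair.mem_lattice, h1, h2]
    constructor
    · rintro ⟨m, n, rfl⟩
      rcases Int.even_or_odd' m with ⟨k, rfl | rfl⟩
      · exact Or.inl ⟨k, n, by push_cast; ring⟩
      · exact Or.inr ⟨k + 1, n, by push_cast; ring⟩
    · rintro (⟨m, n, h⟩ | ⟨m, n, h⟩)
      · exact ⟨2 * m, n, by push_cast; linear_combination h⟩
      · exact ⟨2 * m - 1, n, by push_cast; linear_combination h⟩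
  have key := weierstrassP_eq_add_of_index_two L M hmem (half_left_notMem M)
  have hM0 := weierstrassP_half_sum M
  have hL0 := weierstrassP_half_sum L
  set A := M.weierstrassP (M.ω₁ / 2)
  set B := M.weierstrassP (M.ω₂ / 2)
  set C := M.weierstrassP ((M.ω₁ + M.ω₂) / 2)
  set P := M.weierstrassP (M.ω₁ / 4) with hP
  set Q := M.weierstrassP (M.ω₁ / 4 + M.ω₂ / 2) with hQ
  have k1 : L.weierstrassP (L.ω₁ / 2) = 2 * P - A := by
    rw [key, ← hω, ← weierstrassP_add_of_mem (M.ω₁ / 2 / 2 + M.ω₁ / 2) (neg_mem M.ω₁_mem_lattice),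
      show M.ω₁ / 2 / 2 + M.ω₁ / 2 + -M.ω₁ = -(M.ω₁ / 4) by ring, M.weierstrassP_neg,
      show M.ω₁ / 2 / 2 = M.ω₁ / 4 by ring]
    ring
  have k2 : L.weierstrassP (L.ω₂ / 2) = B + C - A := by
    rw [key, ← h2, show M.ω₂ / 2 + M.ω₁ / 2 = (M.ω₁ + M.ω₂) / 2 by ring]
  have k3 : L.weierstrassP ((L.ω₁ + L.ω₂) / 2) = 2 * Q - A := by
    rw [key, ← hω, ← h2, ← weierstrassP_add_of_mem ((M.ω₁ / 2 + M.ω₂) / 2 + M.ω₁ / 2)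
      (neg_mem (add_mem M.ω₁_mem_lattice M.ω₂_mem_lattice)),
      show (M.ω₁ / 2 + M.ω₂) / 2 + M.ω₁ / 2 + -(M.ω₁ + M.ω₂) = -(M.ω₁ / 4 + M.ω₂ / 2) by ring,
      M.weierstrassP_neg, show (M.ω₁ / 2 + M.ω₂) / 2 = M.ω₁ / 4 + M.ω₂ / 2 by ring]
    ring
  have hquarter : M.ω₁ / 4 ∉ M.lattice := by
    intro h
    refine half_left_notMem M ?_
    have := M.lattice.smul_mem (2 : ℤ) h
    rw [zsmul_eq_mul] at this
    convert this using 1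
    push_cast
    ring
  obtain ⟨K, hK⟩ := exists_weierstrassP_mul_eq (half_left_notMem M)
    (two_mul_half_mem M M.ω₁_mem_lattice)
  -- At the quarter period evenness makes the two factors equal, so the constant is `(P - A) ^ 2`;
  -- at `M.ω₂ / 2` it is `(B - A) * (C - A)`.
  have q1 := hK (M.ω₁ / 4) hquarter (by
    rw [show M.ω₁ / 4 - M.ω₁ / 2 = -(M.ω₁ / 4) by ring, neg_mem_iff]
    exact hquarter)
  rw [show M.ω₁ / 4 - M.ω₁ / 2 = -(M.ω₁ / 4) by ring, M.weierstrassP_neg] at q1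
  have q2 := hK (M.ω₂ / 2) (half_right_notMem M) (by
    rw [← neg_mem_iff, show -(M.ω₂ / 2 - M.ω₁ / 2) = (M.ω₁ - M.ω₂) / 2 by ring]
    exact half_sub_notMem M)
  rw [show M.ω₂ / 2 - M.ω₁ / 2 = (M.ω₂ - M.ω₁) / 2 by ring, weierstrassP_half_neg_sub] at q2
  rw [landen_eq_iff, k1, k2, k3]
  rw [k1, k2, k3] at hL0
  refine ⟨by linear_combination hM0 / 2, hM0, ?_⟩
  have hQ' : Q = 2 * A - P := by linear_combination hL0 / 2 - hM0 / 2
  rw [hQ']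
  linear_combination 16 * q2 - 16 * q1

end Isogeny

end LandenWeierstrass

namespace LandenWeierstrass

open Filter Topology Complex
open scoped Real

/-! ### Expansions of differences of half period values in the nome -/

section QSeries

lemma hasSum_int_inv_sq_of_im_pos {z : ℂ} (hz : 0 < z.im) :
    HasSum (fun m : ℤ => 1 / (z + m) ^ 2)
      (-4 * π ^ 2 * (exp (2 * π * I * z) / (1 - exp (2 * π * I * z)) ^ 2)) := by
  have h1 := EisensteinSeries.qExpansion_identity (k := 1) le_rfl ⟨z, hz⟩
  have hv : ‖exp (2 * π * I * z)‖ < 1 := UpperHalfPlane.norm_exp_two_pi_I_lt_one ⟨z, hz⟩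
  have h2 := (hasSum_coe_mul_geometric_of_norm_lt_one hv).tsum_eq
  simp only [pow_one] at h1
  rw [h2] at h1
  have h3 : Summable (fun m : ℤ => 1 / (z + m) ^ 2) := by
    have := EisensteinSeries.linear_right_summable z 1 (k := 2) (by norm_num)
    simpa using this
  convert h3.hasSum using 1
  refine Eq.trans ?_ h1.symm
  rw [Nat.factorial_one, Nat.cast_one, div_one, show (1 + 1 : ℕ) = 2 from rfl, mul_pow, I_sq]
  ring

lemma div_one_sub_sq_inv (v : ℂ) : v⁻¹ / (1 - v⁻¹) ^ 2 = v / (1 - v) ^ 2 := by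
  by_cases h : v = 0
  · simp [h]
  by_cases h1 : v = 1
  · simp [h1]
  have h2 : 1 - v ≠ 0 := sub_ne_zero.mpr (Ne.symm h1)
  have h3 : v - 1 ≠ 0 := sub_ne_zero.mpr h1
  have h4 : (1 - v⁻¹) = (v - 1) / v := by field_simp
  rw [h4]
  field_simp
  ring

/-- The odd part of the series for `ζ(2)` is `π² / 8`, and each odd number occurs for two integers
`m`. -/
lemma hasSum_int_inv_sq_half :
    HasSum (fun m : ℤ => 1 / ((1 / 2 : ℂ) + m) ^ 2) ((π : ℂ) ^ 2) := by
  have h1 := hasSum_zeta_two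
  have ho : Summable fun n : ℕ => 1 / ((2 * n + 1 : ℕ) : ℝ) ^ 2 :=
    h1.summable.comp_injective (i := fun n : ℕ => 2 * n + 1) (fun a b hab => by simpa using hab)
  have he : HasSum (fun n : ℕ => 1 / ((2 * n : ℕ) : ℝ) ^ 2) (1 / 4 * (π ^ 2 / 6)) := by
    refine (h1.mul_left (1 / 4)).congr_fun fun n => ?_
    push_cast
    ring
  have h2 := h1.unique (HasSum.even_add_odd he ho.hasSum)
  have h3 : HasSum (fun n : ℕ => 1 / ((2 * n + 1 : ℕ) : ℝ) ^ 2) (π ^ 2 / 8) := by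
    convert ho.hasSum using 1
    linarith
  have h4 : HasSum (fun n : ℕ => 4 / (2 * n + 1 : ℂ) ^ 2) (4 * ((π ^ 2 / 8 : ℝ) : ℂ)) := by
    refine ((Complex.hasSum_ofReal.mpr h3).mul_left 4).congr_fun fun n => ?_
    push_cast
    ring
  have h5 := HasSum.of_nat_of_neg_add_one (f := fun m : ℤ => 1 / ((1 / 2 : ℂ) + m) ^ 2)
    (h4.congr_fun fun n => ?_) (h4.congr_fun fun n => ?_)
  · convert h5 using 1
    push_cast
    ring
  · rw [show (1 / 2 + ((n : ℤ) : ℂ)) = (2 * n + 1) / 2 by push_cast; ring, div_pow]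
    norm_num
  · rw [show (1 / 2 + ((-((n : ℤ) + 1) : ℤ) : ℂ)) = -((2 * n + 1) / 2) by push_cast; ring, neg_sq,
      div_pow]
    norm_num

/-- The real point `1 / 2` is needed for the row `n = 0` of the lattice sum at `ω₁ / 2`. Negative
imaginary parts reduce to positive ones by evenness. -/
lemma hasSum_int_inv_sq {z : ℂ} (hz : z.im ≠ 0 ∨ z = 1 / 2) :
    HasSum (fun m : ℤ => 1 / (z + m) ^ 2)
      (-4 * π ^ 2 * (exp (2 * π * I * z) / (1 - exp (2 * π * I * z)) ^ 2)) := by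
  rcases hz with hz | rfl
  · rcases lt_or_gt_of_ne hz with h | h
    · have h1 := hasSum_int_inv_sq_of_im_pos (z := -z) (by simpa using h)
      rw [mul_neg, exp_neg, div_one_sub_sq_inv] at h1
      refine ((Equiv.neg ℤ).hasSum_iff.mpr h1).congr_fun fun m => ?_
      simp only [Function.comp_apply, Equiv.neg_apply]
      rw [show (-z + ((-m : ℤ) : ℂ)) ^ 2 = (z + m) ^ 2 by push_cast; ring]
    · exact hasSum_int_inv_sq_of_im_pos h
  · convert hasSum_int_inv_sq_half using 1
    rw [show 2 * π * I * (1 / 2) = π * I by ring, exp_pi_mul_I]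
    norm_num
    ring

variable (L : PeriodPair)

lemma ω₁_ne_zero : L.ω₁ ≠ 0 := L.indep.ne_zero 0

/-- The difference of two values of `℘` as a double series. -/
lemma hasSum_int_prod_weierstrassP_sub (z w : ℂ) :
    HasSum (fun p : ℤ × ℤ => 1 / (z + p.2 * (L.ω₂ / L.ω₁) + p.1) ^ 2 -
        1 / (w + p.2 * (L.ω₂ / L.ω₁) + p.1) ^ 2)
      (L.ω₁ ^ 2 * (L.weierstrassP (L.ω₁ * z) - L.weierstrassP (L.ω₁ * w))) := by
  have h0 := ω₁_ne_zero L
  have h1 := ((L.hasSum_weierstrassP (L.ω₁ * z)).sub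
    (L.hasSum_weierstrassP (L.ω₁ * w))).mul_left (L.ω₁ ^ 2)
  rw [← ((Equiv.neg _).trans L.latticeEquivProd.symm.toEquiv).hasSum_iff] at h1
  refine h1.congr_fun fun p => ?_
  have h2 : ((L.latticeEquivProd.symm (-p) : L.lattice) : ℂ) = -(p.1 * L.ω₁ + p.2 * L.ω₂) := by
    rw [L.latticeEquiv_symm_apply]
    simp
    ring
  have h3 : ∀ x : ℂ, L.ω₁ * x - -(p.1 * L.ω₁ + p.2 * L.ω₂) =
      L.ω₁ * (x + p.2 * (L.ω₂ / L.ω₁) + p.1) := by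
    intro x
    field_simp
    ring
  simp only [Function.comp_apply, Equiv.trans_apply, Equiv.neg_apply, LinearEquiv.coe_toEquiv]
  rw [h2, h3, h3, mul_pow, mul_pow]
  field_simp
  ring

/-- The function whose values at `exp (2 π i z)` give, up to a constant, the sum over `m : ℤ` of
`(z + m) ^ (-2)`. -/
noncomputable def koebe (v : ℂ) : ℂ := v / (1 - v) ^ 2

lemma koebe_inv (v : ℂ) : koebe v⁻¹ = koebe v := div_one_sub_sq_inv v

lemma hasSum_int_weierstrassP_sub {z w : ℂ}
    (hz : ∀ n : ℤ, (z + n * (L.ω₂ / L.ω₁)).im ≠ 0 ∨ z + n * (L.ω₂ / L.ω₁) = 1 / 2)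
    (hw : ∀ n : ℤ, (w + n * (L.ω₂ / L.ω₁)).im ≠ 0 ∨ w + n * (L.ω₂ / L.ω₁) = 1 / 2) :
    HasSum (fun n : ℤ => -4 * π ^ 2 * (koebe (exp (2 * π * I * (z + n * (L.ω₂ / L.ω₁)))) -
        koebe (exp (2 * π * I * (w + n * (L.ω₂ / L.ω₁))))))
      (L.ω₁ ^ 2 * (L.weierstrassP (L.ω₁ * z) - L.weierstrassP (L.ω₁ * w))) := by
  have h1 : HasSum (fun p : ℤ × ℤ => 1 / (z + p.1 * (L.ω₂ / L.ω₁) + p.2) ^ 2 -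
      1 / (w + p.1 * (L.ω₂ / L.ω₁) + p.2) ^ 2)
      (L.ω₁ ^ 2 * (L.weierstrassP (L.ω₁ * z) - L.weierstrassP (L.ω₁ * w))) :=
    ((Equiv.prodComm ℤ ℤ).hasSum_iff.mpr (hasSum_int_prod_weierstrassP_sub L z w)).congr_fun
      fun _ => rfl
  generalize L.ω₁ ^ 2 * (L.weierstrassP (L.ω₁ * z) - L.weierstrassP (L.ω₁ * w)) = s at *
  generalize L.ω₂ / L.ω₁ = τ at *
  refine h1.prod_fiberwise fun n => ?_
  have h2 := (hasSum_int_inv_sq (hz n)).sub (hasSum_int_inv_sq (hw n))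
  rwa [← mul_sub] at h2

/-- The nome `exp (π i τ)` of a pair of periods with ratio `τ`. -/
noncomputable def nome (τ : ℂ) : ℂ := exp (π * I * τ)

lemma norm_nome (τ : ℂ) : ‖nome τ‖ = Real.exp (-(π * τ.im)) := by
  rw [nome, norm_exp]
  simp

lemma norm_nome_lt_one {τ : ℂ} (h : 0 < τ.im) : ‖nome τ‖ < 1 := by
  rw [norm_nome, Real.exp_lt_one_iff]
  have := Real.pi_pos
  nlinarith [mul_pos this h]

lemma nome_ne_zero (τ : ℂ) : nome τ ≠ 0 := exp_ne_zero _

lemma exp_half_add (τ : ℂ) (n : ℤ) :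
    exp (2 * π * I * (τ / 2 + n * τ)) = nome τ ^ (2 * n + 1) := by
  rw [nome, ← exp_int_mul]
  congr 1
  push_cast
  ring

lemma exp_half_one_add (τ : ℂ) (n : ℤ) :
    exp (2 * π * I * (1 / 2 + n * τ)) = -nome τ ^ (2 * n) := by
  rw [nome, ← exp_int_mul, ← neg_one_mul, ← exp_pi_mul_I, ← exp_add]
  congr 1
  push_cast
  ring

lemma exp_half_one_add' (τ : ℂ) (n : ℤ) :
    exp (2 * π * I * ((1 + τ) / 2 + n * τ)) = -nome τ ^ (2 * n + 1) := by
  rw [nome, ← exp_int_mul, ← neg_one_mul, ← exp_pi_mul_I, ← exp_add]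
  congr 1
  push_cast
  ring

lemma im_half_add_ne_zero {τ : ℂ} (h : 0 < τ.im) (n : ℤ) : (τ / 2 + n * τ).im ≠ 0 := by
  have h1 : (τ / 2 + n * τ).im = ((2 * n + 1 : ℤ) : ℝ) * (τ.im / 2) := by
    simp
    ring
  rw [h1]
  refine mul_ne_zero (Int.cast_ne_zero.mpr ?_) (by positivity)
  omega

lemma im_half_one_add_ne_zero {τ : ℂ} (h : 0 < τ.im) (n : ℤ) :
    ((1 + τ) / 2 + n * τ).im ≠ 0 := by
  have h1 : ((1 + τ) / 2 + n * τ).im = (τ / 2 + n * τ).im := by simp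
  rw [h1]
  exact im_half_add_ne_zero h n

/-- The series `∑ j, q ^ (2 j) (1 + x) / (1 - x) ^ 2` with `x = q ^ (4 j + 2)`. -/
noncomputable def nSeries (q : ℂ) : ℂ :=
  ∑' j : ℕ, q ^ (2 * j) * ((1 + q ^ (4 * j + 2)) / (1 - q ^ (4 * j + 2)) ^ 2)

/-- The series `8 ∑ k ≥ 2, (-1) ^ k q ^ (k - 1) / (1 + q ^ k) ^ 2`, together with the remainder of
its term with `k = 1`. -/
noncomputable def dSeries (q : ℂ) : ℂ :=
  8 * (1 - 1 / (1 + q) ^ 2) + 8 * ∑' k : ℕ, (-1) ^ k * (q ^ (k + 1) / (1 + q ^ (k + 2)) ^ 2)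

lemma summable_pow_div_one_add_sq {q : ℂ} (hq : ‖q‖ < 1) :
    Summable fun k : ℕ => q ^ (k + 1) / (1 + q ^ (k + 1)) ^ 2 := by
  refine Summable.of_norm_bounded
    (g := fun k : ℕ => ‖q‖ ^ k * (1 / (1 - ‖q‖) ^ 2)) ?_ fun k => ?_
  · exact (summable_geometric_of_lt_one (norm_nonneg _) hq).mul_right _
  · have h0 : 0 < 1 - ‖q‖ := by linarith
    have h1 : 1 - ‖q‖ ≤ ‖1 + q ^ (k + 1)‖ := by
      have h2 := norm_sub_le_norm_add (1 : ℂ) (q ^ (k + 1))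
      rw [norm_one, norm_pow] at h2
      have h3 : ‖q‖ ^ (k + 1) ≤ ‖q‖ := pow_le_of_le_one (norm_nonneg _) hq.le (by omega)
      linarith
    rw [norm_div, norm_pow, norm_pow, div_eq_mul_one_div]
    gcongr ?_ * ?_
    · exact pow_le_pow_of_le_one (norm_nonneg _) hq.le (by omega)
    · gcongr

lemma koebe_neg_pow (q : ℂ) (k : ℕ) : koebe (-q ^ k) = -(q ^ k / (1 + q ^ k) ^ 2) := by
  rw [koebe, sub_neg_eq_add, neg_div]

lemma koebe_sub_koebe_neg {u : ℂ} (h : ‖u‖ < 1) :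
    koebe u - koebe (-u) = 2 * u * ((1 + u ^ 2) / (1 - u ^ 2) ^ 2) := by
  have h1 : 1 - u ≠ 0 := fun h0 => by
    rw [← sub_eq_zero.mp h0, norm_one] at h
    exact lt_irrefl _ h
  have h2 : 1 + u ≠ 0 := fun h0 => by
    rw [eq_neg_of_add_eq_zero_right h0, norm_neg, norm_one] at h
    exact lt_irrefl _ h
  rw [koebe, koebe, show 1 - u ^ 2 = (1 - u) * (1 + u) by ring, sub_neg_eq_add]
  field_simp
  ring

lemma weierstrassP_right_sub_add (h : 0 < (L.ω₂ / L.ω₁).im) :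
    L.ω₁ ^ 2 * (L.weierstrassP (L.ω₂ / 2) - L.weierstrassP ((L.ω₁ + L.ω₂) / 2)) =
      -π ^ 2 * (16 * nome (L.ω₂ / L.ω₁) * nSeries (nome (L.ω₂ / L.ω₁))) := by
  have h0 := ω₁_ne_zero L
  have h1 := hasSum_int_weierstrassP_sub L (z := L.ω₂ / L.ω₁ / 2) (w := (1 + L.ω₂ / L.ω₁) / 2)
    (fun n => Or.inl (im_half_add_ne_zero h n)) (fun n => Or.inl (im_half_one_add_ne_zero h n))
  rw [show L.ω₁ * (L.ω₂ / L.ω₁ / 2) = L.ω₂ / 2 by field_simp,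
    show L.ω₁ * ((1 + L.ω₂ / L.ω₁) / 2) = (L.ω₁ + L.ω₂) / 2 by field_simp] at h1
  -- Rows `n` and `-n - 1` have inverse exponentials, on which `koebe` agrees, so they contribute
  -- equally.
  have h2 := h1.nat_add_neg_add_one
  simp only [exp_half_add, exp_half_one_add'] at h2
  have hq := norm_nome_lt_one h
  set q := nome (L.ω₂ / L.ω₁)
  rw [← h2.tsum_eq, nSeries, ← tsum_mul_left, ← tsum_mul_left]
  refine tsum_congr fun n => ?_
  have e1 : q ^ (2 * (n : ℤ) + 1) = q ^ (2 * n + 1) := by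
    norm_cast
  have e2 : q ^ (2 * (-((n : ℤ) + 1)) + 1) = (q ^ (2 * n + 1))⁻¹ := by
    rw [← zpow_natCast, ← zpow_neg]; congr 1
  rw [e1, e2, koebe_inv, ← inv_neg, koebe_inv, koebe_sub_koebe_neg]
  · ring
  · rw [norm_pow]
    exact pow_lt_one₀ (norm_nonneg _) hq (by omega)

lemma weierstrassP_left_sub_add (h : 0 < (L.ω₂ / L.ω₁).im) :
    L.ω₁ ^ 2 * (L.weierstrassP (L.ω₁ / 2) - L.weierstrassP ((L.ω₁ + L.ω₂) / 2)) =
      π ^ 2 * (1 - 8 * nome (L.ω₂ / L.ω₁) +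
        nome (L.ω₂ / L.ω₁) * dSeries (nome (L.ω₂ / L.ω₁))) := by
  have h0 := ω₁_ne_zero L
  have h1 := hasSum_int_weierstrassP_sub L (z := 1 / 2) (w := (1 + L.ω₂ / L.ω₁) / 2)
    (fun n => by
      by_cases hn : n = 0
      · right; simp [hn]
      · left
        have : (1 / 2 + (n : ℂ) * (L.ω₂ / L.ω₁)).im = n * (L.ω₂ / L.ω₁).im := by simp
        rw [this]
        exact mul_ne_zero (Int.cast_ne_zero.mpr hn) h.ne')
    (fun n => Or.inl (im_half_one_add_ne_zero h n))
  rw [show L.ω₁ * (1 / 2) = L.ω₁ / 2 by ring,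
    show L.ω₁ * ((1 + L.ω₂ / L.ω₁) / 2) = (L.ω₁ + L.ω₂) / 2 by field_simp] at h1
  have h2 := h1.nat_add_neg_add_one
  simp only [exp_half_one_add, exp_half_one_add'] at h2
  have hq := norm_nome_lt_one h
  have hq0 := nome_ne_zero (L.ω₂ / L.ω₁)
  set q := nome (L.ω₂ / L.ω₁)
  set f : ℕ → ℂ := fun k => q ^ k / (1 + q ^ k) ^ 2 with hf
  have hs1 : Summable fun k => f (k + 1) := summable_pow_div_one_add_sq hq
  have hs : Summable f := (summable_nat_add_iff 1).mp hs1
  have he : Summable fun n => f (2 * n) := hs.comp_injective (fun a b hab => by simpa using hab)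
  have ho : Summable fun n => f (2 * n + 1) :=
    hs.comp_injective (fun a b hab => by simpa using hab)
  have he' : Summable fun n => f (2 * (n + 1)) := (summable_nat_add_iff 1).mpr he
  -- Here the paired exponents at `ω₁ / 2` are `2 n` and `-2 (n + 1)`. Hence every even index except
  -- 0 is counted twice, and `f 0 = 1 / 4` produces the leading term 1.
  have h3 : HasSum (fun n : ℕ => -4 * (π : ℂ) ^ 2 * (-f (2 * n) + 2 * f (2 * n + 1) -
      f (2 * (n + 1)))) _ :=
    (((he.hasSum.neg.add (ho.hasSum.mul_left 2)).sub he'.hasSum).mul_left _)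
  have h4 := h2.unique (h3.congr_fun fun n => ?_)
  · rw [h4]
    have hz := he.tsum_eq_zero_add
    have hf0 : f 0 = 1 / 4 := by norm_num [hf]
    rw [mul_zero, hf0] at hz
    have h5 : HasSum (fun k : ℕ => (-1 : ℂ) ^ k * f k) (∑' n, f (2 * n) + -∑' n, f (2 * n + 1)) := by
      refine HasSum.even_add_odd ?_ ?_
      · simpa [pow_mul] using he.hasSum
      · simpa [pow_mul, pow_succ] using ho.hasSum.neg
    have h6 := h5.summable.tsum_eq_zero_add
    have h7 := ((summable_nat_add_iff 1).mpr h5.summable).tsum_eq_zero_add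
    rw [h5.tsum_eq, h7, hf0] at h6
    have h8 : q * ∑' k : ℕ, (-1) ^ k * (q ^ (k + 1) / (1 + q ^ (k + 2)) ^ 2) =
        ∑' k : ℕ, (-1) ^ (k + 1 + 1) * f (k + 1 + 1) := by
      rw [← tsum_mul_left]
      refine tsum_congr fun k => ?_
      simp only [hf]
      ring
    have h9 : q * dSeries q = 8 * q * (1 - 1 / (1 + q) ^ 2) +
        8 * ∑' k : ℕ, (-1) ^ (k + 1 + 1) * f (k + 1 + 1) := by
      rw [← h8, dSeries]
      ring
    rw [h9]
    have hf1 : f 1 = q * (1 / (1 + q) ^ 2) := by simp [hf]; ring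
    simp only [zero_add, hf1, pow_one, pow_zero] at h6
    linear_combination (4 * (π : ℂ) ^ 2) * (-hz) + 8 * (π : ℂ) ^ 2 * h6
  · have e1 : q ^ (2 * (n : ℤ)) = q ^ (2 * n) := by
      norm_cast
    have e2 : q ^ (2 * (n : ℤ) + 1) = q ^ (2 * n + 1) := by
      norm_cast
    have e3 : q ^ (2 * (-((n : ℤ) + 1)) + 1) = (q ^ (2 * n + 1))⁻¹ := by
      rw [← zpow_natCast, ← zpow_neg]; congr 1
    have e4 : q ^ (2 * (-((n : ℤ) + 1))) = (q ^ (2 * (n + 1)))⁻¹ := by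
      rw [← zpow_natCast, ← zpow_neg]; congr 1
    rw [e1, e2, e3, e4, ← inv_neg, koebe_inv, ← inv_neg, koebe_inv, koebe_neg_pow, koebe_neg_pow,
      koebe_neg_pow]
    simp only [hf]
    ring

/-- If the periods have the same absolute value, complex conjugation exchanges
the half periods `ω₁ / 2` and `ω₂ / 2`. -/
lemma norm_weierstrassP_sub_eq_of_norm_eq_one (h : ‖L.ω₂ / L.ω₁‖ = 1) :
    ‖L.weierstrassP (L.ω₁ / 2) - L.weierstrassP ((L.ω₁ + L.ω₂) / 2)‖ =
      ‖L.weierstrassP (L.ω₂ / 2) - L.weierstrassP ((L.ω₁ + L.ω₂) / 2)‖ := by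
  have h0 := ω₁_ne_zero L
  have h1 := hasSum_int_prod_weierstrassP_sub L (1 / 2) ((1 + L.ω₂ / L.ω₁) / 2)
  have h2 := hasSum_int_prod_weierstrassP_sub L (L.ω₂ / L.ω₁ / 2) ((1 + L.ω₂ / L.ω₁) / 2)
  rw [show L.ω₁ * (1 / 2) = L.ω₁ / 2 by ring,
    show L.ω₁ * ((1 + L.ω₂ / L.ω₁) / 2) = (L.ω₁ + L.ω₂) / 2 by field_simp] at h1
  rw [show L.ω₁ * (L.ω₂ / L.ω₁ / 2) = L.ω₂ / 2 by field_simp,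
    show L.ω₁ * ((1 + L.ω₂ / L.ω₁) / 2) = (L.ω₁ + L.ω₂) / 2 by field_simp] at h2
  set τ := L.ω₂ / L.ω₁
  have hτ0 : τ ≠ 0 := by
    rw [← norm_pos_iff, h]
    exact one_pos
  have hconj : (starRingEnd ℂ) τ = τ⁻¹ := by
    rw [inv_def, normSq_eq_norm_sq, h]
    simp
  -- Conjugation replaces `τ` by `τ⁻¹`. Clearing this denominator exchanges the two summation
  -- indices and brings out the factor `τ ^ 2`, of absolute value 1.
  have h3 := ((Equiv.prodComm ℤ ℤ).hasSum_iff.mpr h2).mul_left (τ ^ 2)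
  have h4 := (h1.map (starRingEnd ℂ) continuous_conj).unique (h3.congr_fun fun p => ?_)
  · have h5 := congrArg norm h4
    rw [norm_conj, norm_mul, norm_mul, norm_pow, norm_pow, norm_mul, h] at h5
    have h6 : (0 : ℝ) < ‖L.ω₁‖ ^ 2 := by have := norm_pos_iff.mpr h0; positivity
    rw [norm_pow] at h5
    nlinarith
  · obtain ⟨m, n⟩ := p
    clear_value τ
    have e1 : ((1 / 2 : ℂ) + n * τ⁻¹ + m) = (τ / 2 + m * τ + n) / τ := by
      field_simp
      ring
    have e2 : ((1 + τ⁻¹) / 2 + n * τ⁻¹ + m) = ((1 + τ) / 2 + m * τ + n) / τ := by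
      field_simp
      ring
    simp only [Function.comp_apply, Equiv.prodComm_apply, Prod.swap, map_sub, map_div₀, map_one,
      map_pow, map_add, map_mul, map_intCast, hconj, map_ofNat]
    rw [e1, e2, div_pow, div_pow]
    generalize τ / 2 + m * τ + n = x
    generalize (1 + τ) / 2 + m * τ + n = y
    simp only [one_div, inv_div]
    field_simp

end QSeries

end LandenWeierstrass

namespace LandenWeierstrass

open Filter Topology Complex
open scoped Real

/-! ### Lipschitz bounds for the series and growth of their quotient -/

section Estimates

/-- A series of functions whose terms are Lipschitz with geometrically decaying constants. -/
lemma norm_tsum_sub_tsum_le {a : ℕ → ℂ → ℂ} {C r ρ : ℝ} (hr0 : 0 ≤ r) (hr1 : r < 1) (hρ : 0 ≤ ρ)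
    (ha : ∀ j q p, ‖q‖ ≤ ρ → ‖p‖ ≤ ρ → ‖a j q - a j p‖ ≤ C * ‖q - p‖ * r ^ j)
    (h0 : Summable fun j => a j 0) {q p : ℂ} (hq : ‖q‖ ≤ ρ) (hp : ‖p‖ ≤ ρ) :
    ‖∑' j, a j q - ∑' j, a j p‖ ≤ C * ‖q - p‖ * (1 - r)⁻¹ := by
  have hs : ∀ q, ‖q‖ ≤ ρ → Summable fun j => a j q := by
    intro q hq
    have h1 : Summable fun j => a j q - a j 0 :=
      Summable.of_norm_bounded ((summable_geometric_of_lt_one hr0 hr1).mul_left (C * ‖q - 0‖))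
        fun j => ha j q 0 hq (by simpa using hρ)
    simpa using h1.add h0
  rw [← (hs q hq).tsum_sub (hs p hp)]
  exact tsum_of_norm_bounded ((hasSum_geometric_of_lt_one hr0 hr1).mul_left _)
    fun j => ha j q p hq hp

variable {q p : ℂ}

/-- The natural factor `(k + 1) (1/18) ^ k` is absorbed into `(1/9) ^ k`, since `k + 1 ≤ 2 ^ k`. -/
lemma norm_pow_succ_sub_pow_succ_le (hq : ‖q‖ ≤ 1 / 18) (hp : ‖p‖ ≤ 1 / 18) (k : ℕ) :
    ‖q ^ (k + 1) - p ^ (k + 1)‖ ≤ (1 / 9) ^ k * ‖q - p‖ := by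
  induction k with
  | zero => simp
  | succ k ih =>
    have h1 : q ^ (k + 1 + 1) - p ^ (k + 1 + 1) =
        q * (q ^ (k + 1) - p ^ (k + 1)) + p ^ (k + 1) * (q - p) := by ring
    have h2 : ‖p‖ ^ (k + 1) ≤ 1 / 18 * (1 / 9) ^ k := by
      rw [pow_succ, mul_comm]
      have : ‖p‖ ≤ 1 / 9 := by linarith
      gcongr
    rw [h1]
    calc _ ≤ ‖q‖ * ‖q ^ (k + 1) - p ^ (k + 1)‖ + ‖p‖ ^ (k + 1) * ‖q - p‖ := by
          refine (norm_add_le _ _).trans_eq ?_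
          rw [norm_mul, norm_mul, norm_pow]
      _ ≤ 1 / 18 * ((1 / 9) ^ k * ‖q - p‖) + 1 / 18 * (1 / 9) ^ k * ‖q - p‖ := by gcongr
      _ = (1 / 9) ^ (k + 1) * ‖q - p‖ := by ring

lemma norm_pow_succ_le (hq : ‖q‖ ≤ 1 / 18) (k : ℕ) : ‖q ^ (k + 1)‖ ≤ 1 / 18 * (1 / 18) ^ k := by
  rw [norm_pow, pow_succ, mul_comm]
  gcongr

lemma norm_pow_add_two_le (hq : ‖q‖ ≤ 1 / 18) (k : ℕ) : ‖q ^ (k + 2)‖ ≤ 1 / 324 := by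
  refine (norm_pow_succ_le hq (k + 1)).trans ?_
  have : (1 / 18 : ℝ) ^ k ≤ 1 := pow_le_one₀ (by norm_num) (by norm_num)
  rw [pow_succ]
  linarith

lemma le_norm_one_add {x : ℂ} {r : ℝ} (hx : ‖x‖ ≤ r) : 1 - r ≤ ‖1 + x‖ := by
  have := norm_sub_le_norm_add (1 : ℂ) x
  rw [norm_one] at this
  linarith

lemma norm_inv_sq_sub_inv_sq_le {x y : ℂ} {r : ℝ} (hr : r < 1) (hx : ‖x‖ ≤ r) (hy : ‖y‖ ≤ r) :
    ‖1 / (1 + x) ^ 2 - 1 / (1 + y) ^ 2‖ ≤ (2 + 2 * r) / (1 - r) ^ 4 * ‖x - y‖ := by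
  have hr' : 0 < 1 - r := by linarith
  have hx1 := le_norm_one_add hx
  have hy1 := le_norm_one_add hy
  have hx0 : 1 + x ≠ 0 := norm_pos_iff.mp (by linarith)
  have hy0 : 1 + y ≠ 0 := norm_pos_iff.mp (by linarith)
  have h1 : 1 / (1 + x) ^ 2 - 1 / (1 + y) ^ 2 =
      (2 + x + y) / ((1 + x) ^ 2 * (1 + y) ^ 2) * (y - x) := by
    field_simp
    ring
  have h2 : ‖2 + x + y‖ ≤ 2 + 2 * r := by
    refine (norm_add₃_le).trans ?_
    rw [Complex.norm_ofNat]
    linarith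
  have h3 : (1 - r) ^ 4 ≤ ‖1 + x‖ ^ 2 * ‖1 + y‖ ^ 2 := by
    calc (1 - r) ^ 4 = (1 - r) ^ 2 * (1 - r) ^ 2 := by ring
      _ ≤ _ := by gcongr
  have hr0 : 0 ≤ r := (norm_nonneg _).trans hx
  rw [h1, norm_mul, norm_div, norm_mul, norm_pow, norm_pow, norm_sub_rev y x]
  gcongr

lemma norm_inv_one_add_sq_le {x : ℂ} (hx : ‖x‖ ≤ 1 / 324) : ‖1 / (1 + x) ^ 2‖ ≤ 101 / 100 := by
  have hx1 := le_norm_one_add hx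
  rw [norm_div, norm_one, norm_pow]
  calc 1 / ‖1 + x‖ ^ 2 ≤ 1 / (1 - 1 / 324) ^ 2 := by gcongr
    _ ≤ 101 / 100 := by norm_num

lemma norm_one_add_div_one_sub_sq_le {x : ℂ} (hx : ‖x‖ ≤ 1 / 324) :
    ‖(1 + x) / (1 - x) ^ 2‖ ≤ 102 / 100 := by
  have hx1 := norm_inv_one_add_sq_le (x := -x) (by simpa using hx)
  have hx2 : ‖1 + x‖ ≤ 1 + 1 / 324 := (norm_add_le _ _).trans (by rw [norm_one]; linarith)
  rw [← sub_eq_add_neg] at hx1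
  rw [div_eq_mul_one_div, norm_mul]
  calc _ ≤ (1 + 1 / 324) * (101 / 100) := by gcongr
    _ ≤ (102 / 100 : ℝ) := by norm_num

lemma norm_one_add_div_one_sub_sq_sub_le {x y : ℂ} (hx : ‖x‖ ≤ 1 / 324) (hy : ‖y‖ ≤ 1 / 324) :
    ‖(1 + x) / (1 - x) ^ 2 - (1 + y) / (1 - y) ^ 2‖ ≤ 31 / 10 * ‖x - y‖ := by
  have h1 := norm_inv_sq_sub_inv_sq_le (x := -x) (y := -y) (r := 1 / 324) (by norm_num)
    (by simpa using hx) (by simpa using hy)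
  have h2 := norm_inv_one_add_sq_le (x := -x) (by simpa using hx)
  have h3 : ‖1 + y‖ ≤ 1 + 1 / 324 := (norm_add_le _ _).trans (by rw [norm_one]; linarith)
  rw [← sub_eq_add_neg, ← sub_eq_add_neg, show -x - -y = -(x - y) by ring, norm_neg] at h1
  rw [← sub_eq_add_neg] at h2
  have h4 : (1 + x) / (1 - x) ^ 2 - (1 + y) / (1 - y) ^ 2 =
      (x - y) * (1 / (1 - x) ^ 2) + (1 + y) * (1 / (1 - x) ^ 2 - 1 / (1 - y) ^ 2) := by ring
  rw [h4]
  calc _ ≤ ‖x - y‖ * ‖1 / (1 - x) ^ 2‖ + ‖1 + y‖ * ‖1 / (1 - x) ^ 2 - 1 / (1 - y) ^ 2‖ := by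
        refine (norm_add_le _ _).trans_eq ?_
        rw [norm_mul, norm_mul]
    _ ≤ ‖x - y‖ * (101 / 100) +
        (1 + 1 / 324) * ((2 + 2 * (1 / 324)) / (1 - 1 / 324) ^ 4 * ‖x - y‖) := by gcongr
    _ = (101 / 100 + (1 + 1 / 324) * ((2 + 2 * (1 / 324)) / (1 - 1 / 324) ^ 4)) * ‖x - y‖ := by
        ring
    _ ≤ 31 / 10 * ‖x - y‖ := by gcongr; norm_num

lemma nSeries_zero : nSeries 0 = 1 := by
  rw [nSeries, tsum_eq_single 0]
  · simp
  · intro j hj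
    simp [hj]

lemma dSeries_zero : dSeries 0 = 0 := by
  simp [dSeries]

lemma norm_nSeries_sub_le (hq : ‖q‖ ≤ 1 / 18) (hp : ‖p‖ ≤ 1 / 18) :
    ‖nSeries q - nSeries p‖ ≤ 27 / 50 * ‖q - p‖ := by
  have key := norm_tsum_sub_tsum_le (C := 36 / 100) (r := 1 / 3) (ρ := 1 / 18)
    (a := fun j q => q ^ (2 * j) * ((1 + q ^ (4 * j + 2)) / (1 - q ^ (4 * j + 2)) ^ 2))
    (by norm_num) (by norm_num) (by norm_num) ?_ ?_ hq hp
  · refine key.trans_eq ?_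
    norm_num
    ring
  · intro j q p hq hp
    have hq2 := norm_pow_add_two_le hq (4 * j)
    have hp2 := norm_pow_add_two_le hp (4 * j)
    have h1 := norm_one_add_div_one_sub_sq_sub_le hq2 hp2
    have h2 := norm_one_add_div_one_sub_sq_le hq2
    have h3 := norm_pow_succ_sub_pow_succ_le hq hp (4 * j + 1)
    have h0 := norm_nonneg (q - p)
    -- For `j = 0` the prefactor is constant and only the quotient varies; the later terms need the
    -- product rule.
    rcases j with _ | i
    · simp only [mul_zero, zero_add, pow_zero, one_mul, mul_one] at *
      refine h1.trans ?_
      norm_num at h3 ⊢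
      linarith
    · have h4 := norm_pow_succ_sub_pow_succ_le hq hp (2 * i + 1)
      have h5 := norm_pow_succ_le hp (2 * i + 1)
      have h6 : (1 / 9 : ℝ) ^ (2 * i + 1) ≤ 1 / 9 * (1 / 3) ^ i := by
        rw [pow_succ, pow_mul, mul_comm]
        gcongr
        norm_num
      have h7 : (1 / 18 : ℝ) ^ (2 * i + 1) ≤ 1 / 18 * (1 / 3) ^ i := by
        rw [pow_succ, pow_mul, mul_comm]
        gcongr
        norm_num
      have h8 : (1 / 9 : ℝ) ^ (4 * (i + 1) + 1) ≤ 1 / 9 :=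
        pow_le_of_le_one (by norm_num) (by norm_num) (by omega)
      have e : 2 * (i + 1) = 2 * i + 1 + 1 := by ring
      rw [e]
      set X := (1 + q ^ (4 * (i + 1) + 2)) / (1 - q ^ (4 * (i + 1) + 2)) ^ 2
      set Y := (1 + p ^ (4 * (i + 1) + 2)) / (1 - p ^ (4 * (i + 1) + 2)) ^ 2
      have h9 : q ^ (2 * i + 1 + 1) * X - p ^ (2 * i + 1 + 1) * Y =
          (q ^ (2 * i + 1 + 1) - p ^ (2 * i + 1 + 1)) * X + p ^ (2 * i + 1 + 1) * (X - Y) := by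
        ring
      rw [h9]
      calc _ ≤ ‖q ^ (2 * i + 1 + 1) - p ^ (2 * i + 1 + 1)‖ * ‖X‖ +
            ‖p ^ (2 * i + 1 + 1)‖ * ‖X - Y‖ := by
            refine (norm_add_le _ _).trans_eq ?_
            rw [norm_mul, norm_mul]
        _ ≤ (1 / 9 * (1 / 3) ^ i * ‖q - p‖) * (102 / 100) +
            (1 / 18 * (1 / 18 * (1 / 3) ^ i)) * (31 / 10 * (1 / 9 * ‖q - p‖)) := by
            gcongr
            · exact h4.trans (by gcongr)
            · exact h5.trans (by gcongr)
            · exact h1.trans (by gcongr; exact h3.trans (by gcongr))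
        _ = (1 / 9 * (102 / 100) + 1 / 18 * (1 / 18) * (31 / 10) * (1 / 9)) *
              (‖q - p‖ * (1 / 3) ^ i) := by ring
        _ ≤ 36 / 100 * (1 / 3) * (‖q - p‖ * (1 / 3) ^ i) := by gcongr; norm_num
        _ = _ := by ring
  · refine summable_of_hasFiniteSupport ((Set.finite_singleton 0).subset fun j hj => ?_)
    by_contra h
    have : j ≠ 0 := h
    simp [this] at hj

lemma norm_dSeries_sub_le (hq : ‖q‖ ≤ 1 / 18) (hp : ‖p‖ ≤ 1 / 18) :
    ‖dSeries q - dSeries p‖ ≤ 31 * ‖q - p‖ := by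
  have key := norm_tsum_sub_tsum_le (C := 103 / 100) (r := 1 / 9) (ρ := 1 / 18)
    (a := fun k q => (-1) ^ k * (q ^ (k + 1) / (1 + q ^ (k + 2)) ^ 2))
    (by norm_num) (by norm_num) (by norm_num) ?_ ?_ hq hp
  · have h1 := norm_inv_sq_sub_inv_sq_le (r := 1 / 18) (by norm_num) hp hq
    rw [norm_sub_rev p q] at h1
    have h2 : dSeries q - dSeries p = 8 * (1 / (1 + p) ^ 2 - 1 / (1 + q) ^ 2) +
        8 * (∑' k : ℕ, (-1) ^ k * (q ^ (k + 1) / (1 + q ^ (k + 2)) ^ 2) -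
          ∑' k : ℕ, (-1) ^ k * (p ^ (k + 1) / (1 + p ^ (k + 2)) ^ 2)) := by
      rw [dSeries, dSeries]
      ring
    rw [h2]
    refine (norm_add_le _ _).trans ?_
    rw [norm_mul, norm_mul, Complex.norm_ofNat]
    have h0 := norm_nonneg (q - p)
    norm_num at h1 key ⊢
    linarith
  · intro k q p hq hp
    have hq2 := norm_pow_add_two_le hq k
    have hp2 := norm_pow_add_two_le hp k
    have h1 := norm_inv_sq_sub_inv_sq_le (by norm_num) hq2 hp2
    have h2 := norm_inv_one_add_sq_le hq2
    have h3 := norm_pow_succ_sub_pow_succ_le hq hp (k + 1)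
    have h4 := norm_pow_succ_sub_pow_succ_le hq hp k
    have h5 := norm_pow_succ_le hp k
    have h6 : (1 / 18 : ℝ) ^ k ≤ (1 / 9) ^ k := by gcongr; norm_num
    have h7 : (1 / 9 : ℝ) ^ (k + 1) ≤ 1 / 9 :=
      pow_le_of_le_one (by norm_num) (by norm_num) (by omega)
    have h0 := norm_nonneg (q - p)
    rw [← mul_sub, norm_mul, norm_pow, norm_neg, norm_one, one_pow, one_mul]
    set X := 1 / (1 + q ^ (k + 2)) ^ 2 with hX
    set Y := 1 / (1 + p ^ (k + 2)) ^ 2 with hY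
    have h9 : q ^ (k + 1) / (1 + q ^ (k + 2)) ^ 2 - p ^ (k + 1) / (1 + p ^ (k + 2)) ^ 2 =
        (q ^ (k + 1) - p ^ (k + 1)) * X + p ^ (k + 1) * (X - Y) := by
      rw [hX, hY]
      ring
    rw [h9]
    calc _ ≤ ‖q ^ (k + 1) - p ^ (k + 1)‖ * ‖X‖ + ‖p ^ (k + 1)‖ * ‖X - Y‖ := by
          refine (norm_add_le _ _).trans_eq ?_
          rw [norm_mul, norm_mul]
      _ ≤ ((1 / 9) ^ k * ‖q - p‖) * (101 / 100) + (1 / 18 * (1 / 9) ^ k) *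
          ((2 + 2 * (1 / 324)) / (1 - 1 / 324) ^ 4 * (1 / 9 * ‖q - p‖)) := by
          gcongr
          · exact h5.trans (by gcongr)
          · exact h1.trans (by gcongr; exact h3.trans (by gcongr))
      _ = (101 / 100 + 1 / 18 * ((2 + 2 * (1 / 324)) / (1 - 1 / 324) ^ 4) * (1 / 9)) *
            ‖q - p‖ * (1 / 9) ^ k := by ring
      _ ≤ 103 / 100 * ‖q - p‖ * (1 / 9) ^ k := by gcongr; norm_num
  · simp [summable_zero]

lemma norm_nSeries_sub_one_le (hq : ‖q‖ ≤ 1 / 18) : ‖nSeries q - 1‖ ≤ 3 / 100 := by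
  have := norm_nSeries_sub_le hq (p := 0) (by norm_num)
  rw [nSeries_zero, sub_zero] at this
  linarith

lemma norm_dSeries_le (hq : ‖q‖ ≤ 1 / 18) : ‖dSeries q‖ ≤ 31 / 18 := by
  have := norm_dSeries_sub_le hq (p := 0) (by norm_num)
  rw [dSeries_zero, sub_zero, sub_zero] at this
  linarith

lemma norm_nSeries_le (hq : ‖q‖ ≤ 1 / 18) : ‖nSeries q‖ ≤ 103 / 100 := by
  have h1 := norm_nSeries_sub_one_le hq
  have h2 := norm_sub_norm_le (nSeries q) 1
  rw [norm_one] at h2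
  linarith

lemma le_norm_nSeries (hq : ‖q‖ ≤ 1 / 18) : 97 / 100 ≤ ‖nSeries q‖ := by
  have h1 := norm_nSeries_sub_one_le hq
  have h2 := norm_sub_norm_le 1 (nSeries q)
  rw [norm_one, norm_sub_rev] at h2
  linarith

/-- The quotient `(1 - 8 q + ⋯) / q`, to be compared with `16 nSeries q`. -/
noncomputable def uSeries (q : ℂ) : ℂ := q⁻¹ - 8 + dSeries q

/-- The comparison of `uSeries / nSeries` at two points `q`, `p` with `|q| < |p|`. -/
lemma norm_uSeries_mul_nSeries_lt (hq0 : q ≠ 0) (hp0 : p ≠ 0) (hp : ‖p‖ ≤ 1 / 18)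
    (hqp : ‖q‖ < ‖p‖) (hW : ‖q⁻¹ - p⁻¹‖ ≤ 107 / 100 * (‖q⁻¹‖ - ‖p⁻¹‖)) :
    ‖uSeries p‖ * ‖nSeries q‖ < ‖uSeries q‖ * ‖nSeries p‖ := by
  have hq : ‖q‖ ≤ 1 / 18 := hqp.le.trans hp
  have hqpos : 0 < ‖q‖ := norm_pos_iff.mpr hq0
  have hppos : 0 < ‖p‖ := norm_pos_iff.mpr hp0
  have hab : ‖p⁻¹‖ < ‖q⁻¹‖ := by
    rw [norm_inv, norm_inv]
    exact inv_strictAnti₀ hqpos hqp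
  have ha : 18 ≤ ‖p⁻¹‖ := by
    rw [norm_inv, le_inv_comm₀ (by norm_num) hppos]
    simpa using hp
  have hd := norm_dSeries_sub_le hq hp
  have hn := norm_nSeries_sub_le hq hp
  have hnp := le_norm_nSeries hp
  have hdist : ‖q - p‖ * (‖p⁻¹‖ * ‖q⁻¹‖) = ‖q⁻¹ - p⁻¹‖ := by
    rw [← norm_mul, ← norm_mul, norm_sub_rev q⁻¹]
    congr 1
    field_simp
  -- The same `c` is used at both points, so that `uSeries` compares as `B + c` against `A + c` up
  -- to the variation of `dSeries`.
  set c := -8 + dSeries p with hc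
  have hcn : ‖c‖ ≤ 98 / 10 := by
    refine (norm_add_le _ _).trans ?_
    rw [norm_neg, Complex.norm_ofNat]
    have := norm_dSeries_le hp
    linarith
  have hup : uSeries p = p⁻¹ + c := by rw [uSeries, hc]; ring
  have huq : uSeries q = q⁻¹ + c + (dSeries q - dSeries p) := by rw [uSeries, hc]; ring
  set A := p⁻¹
  set B := q⁻¹
  set a := ‖A‖
  set b := ‖B‖
  have hexp : ∀ X : ℂ, ‖X + c‖ ^ 2 = ‖X‖ ^ 2 + ‖c‖ ^ 2 + 2 * (X * (starRingEnd ℂ) c).re := by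
    intro X
    rw [Complex.sq_norm, Complex.sq_norm, Complex.sq_norm, normSq_add]
  have hre : -(‖B - A‖ * ‖c‖) ≤ (B * (starRingEnd ℂ) c).re - (A * (starRingEnd ℂ) c).re := by
    rw [← Complex.sub_re, ← sub_mul, ← norm_conj c, ← norm_mul]
    exact (abs_le.mp (abs_re_le_norm _)).1
  -- The cross term costs at most `2 · 1.07 · 9.8 (b - a)`, which is below `20.98 (b - a)`.
  have hdiff : (b - a) * (a + b - 20.98) ≤ ‖B + c‖ ^ 2 - ‖A + c‖ ^ 2 := by
    have h1 : ‖B - A‖ * ‖c‖ ≤ 107 / 100 * (b - a) * (98 / 10) := by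
      gcongr
    rw [hexp, hexp]
    nlinarith
  have hB : ‖B + c‖ ≤ b + 98 / 10 := (norm_add_le _ _).trans (by gcongr)
  have hA : ‖A + c‖ ≤ a + 98 / 10 := (norm_add_le _ _).trans (by gcongr)
  -- Otherwise `a + b - 20.98 ≤ 0.26 (a + b + 19.6)`, which fails because `a + b > 36`.
  have hgap : 26 / 100 * (b - a) ≤ ‖B + c‖ - ‖A + c‖ := by
    by_contra! hlt
    have h1 : ‖B + c‖ ^ 2 - ‖A + c‖ ^ 2 ≤ 26 / 100 * (b - a) * (a + b + 19.6) := by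
      have h2 : ‖B + c‖ ^ 2 - ‖A + c‖ ^ 2 =
          (‖B + c‖ - ‖A + c‖) * (‖B + c‖ + ‖A + c‖) := by ring
      rw [h2]
      have h3 : 0 ≤ ‖B + c‖ + ‖A + c‖ := by positivity
      calc _ ≤ 26 / 100 * (b - a) * (‖B + c‖ + ‖A + c‖) := by gcongr
        _ ≤ _ := by
          have : 0 ≤ 26 / 100 * (b - a) := by linarith
          exact mul_le_mul_of_nonneg_left (by linarith) this
    nlinarith
  have hqp' : ‖q - p‖ * a ≤ 107 / 1800 * (b - a) := by
    have h1 : ‖q - p‖ * a * 18 ≤ ‖q - p‖ * a * b := by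
      gcongr
      linarith
    nlinarith
  have hqp'' : ‖q - p‖ * 18 ≤ ‖q - p‖ * a := by gcongr
  -- The variation of `dSeries` is at most `31 · 1.07 / 18²` times `b - a`, less than the 0.11 given
  -- up here.
  have hU : 15 / 100 * (b - a) ≤ ‖uSeries q‖ - ‖uSeries p‖ := by
    have h1 : ‖B + c‖ - ‖dSeries q - dSeries p‖ ≤ ‖uSeries q‖ := by
      rw [huq]
      exact norm_sub_le_norm_add _ _
    rw [hup]
    linarith
  have hN : ‖nSeries q‖ ≤ ‖nSeries p‖ + 27 / 50 * ‖q - p‖ := by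
    have := norm_sub_norm_le (nSeries q) (nSeries p)
    linarith
  have hup' : ‖uSeries p‖ ≤ a + 98 / 10 := hup ▸ hA
  have h0 := norm_nonneg (q - p)
  calc _ ≤ ‖uSeries p‖ * (‖nSeries p‖ + 27 / 50 * ‖q - p‖) := by gcongr
    _ ≤ ‖uSeries p‖ * ‖nSeries p‖ + (a + 98 / 10) * (27 / 50 * ‖q - p‖) := by
        rw [mul_add]
        gcongr
    _ < ‖uSeries p‖ * ‖nSeries p‖ + 15 / 100 * (b - a) * (97 / 100) := by
        nlinarith
    _ ≤ ‖uSeries p‖ * ‖nSeries p‖ + (‖uSeries q‖ - ‖uSeries p‖) * ‖nSeries p‖ := by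
        have : 0 ≤ ‖uSeries q‖ - ‖uSeries p‖ := by linarith
        gcongr
    _ = _ := by ring

/-- This is `|∫₀¹ z exp(t z) dt| ≤ |z| ∫₀¹ exp(t Re z) dt`, obtained by comparing derivatives. -/
lemma norm_exp_sub_one_mul_re_le {z : ℂ} (hz : 0 < z.re) :
    ‖exp z - 1‖ * z.re ≤ ‖z‖ * (Real.exp z.re - 1) := by
  have hf : ∀ t : ℝ, HasDerivAt (fun t : ℝ => exp (t * z) - 1) (exp (t * z) * z) t := by
    intro t
    have h1 : HasDerivAt (fun t : ℝ => (t : ℂ) * z) z t := by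
      simpa using (hasDerivAt_id t).ofReal_comp.mul_const z
    exact h1.cexp.sub_const 1
  have hB : ∀ t : ℝ, HasDerivAt (fun t : ℝ => ‖z‖ * (Real.exp (t * z.re) - 1) / z.re)
      (‖z‖ * Real.exp (t * z.re)) t := by
    intro t
    have h1 : HasDerivAt (fun t : ℝ => t * z.re) z.re t := by
      simpa using (hasDerivAt_id t).mul_const z.re
    refine (((h1.exp.sub_const 1).const_mul ‖z‖).div_const z.re).congr_deriv ?_
    rw [← mul_assoc, mul_div_cancel_right₀ _ hz.ne']
  have key := image_norm_le_of_norm_deriv_right_le_deriv_boundary (a := 0) (b := 1)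
    (f := fun t : ℝ => exp (t * z) - 1) (f' := fun t => exp (t * z) * z)
    (fun t _ => (hf t).continuousAt.continuousWithinAt)
    (fun t _ => (hf t).hasDerivWithinAt) (by simp) hB
    (fun t _ => by rw [norm_mul, norm_exp]; simp [mul_comm]) (x := 1) (by simp)
  simp only [ofReal_one, one_mul] at key
  rwa [le_div_iff₀ hz] at key

end Estimates

end LandenWeierstrass

namespace LandenWeierstrass

open Filter Topology Complex
open scoped Real

/-! ### Comparison of half period differences inside and outside the unit circle -/

section Comparison

variable (L : PeriodPair)

lemma norm_left_sub_add (h : 0 < (L.ω₂ / L.ω₁).im) :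
    ‖L.ω₁‖ ^ 2 * ‖L.weierstrassP (L.ω₁ / 2) - L.weierstrassP ((L.ω₁ + L.ω₂) / 2)‖ =
      π ^ 2 * ‖nome (L.ω₂ / L.ω₁)‖ * ‖uSeries (nome (L.ω₂ / L.ω₁))‖ := by
  have h1 := congrArg norm (weierstrassP_left_sub_add L h)
  have hq := nome_ne_zero (L.ω₂ / L.ω₁)
  rw [norm_mul, norm_pow] at h1
  rw [h1, uSeries]
  generalize nome (L.ω₂ / L.ω₁) = q at *
  rw [show 1 - 8 * q + q * dSeries q = q * (q⁻¹ - 8 + dSeries q) by field_simp,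
    norm_mul, norm_mul, norm_pow, norm_real, Real.norm_of_nonneg Real.pi_pos.le, mul_assoc]

lemma norm_right_sub_add (h : 0 < (L.ω₂ / L.ω₁).im) :
    ‖L.ω₁‖ ^ 2 * ‖L.weierstrassP (L.ω₂ / 2) - L.weierstrassP ((L.ω₁ + L.ω₂) / 2)‖ =
      π ^ 2 * ‖nome (L.ω₂ / L.ω₁)‖ * (16 * ‖nSeries (nome (L.ω₂ / L.ω₁))‖) := by
  have h1 := congrArg norm (weierstrassP_right_sub_add L h)
  rw [norm_mul, norm_pow] at h1
  rw [h1]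
  simp only [norm_mul, norm_neg, norm_pow, norm_real, Real.norm_of_nonneg Real.pi_pos.le,
    Complex.norm_ofNat]
  ring

lemma norm_left_sub_right (h : 0 < (L.ω₂ / L.ω₁).im) :
    ‖L.ω₁‖ ^ 2 * ‖L.weierstrassP (L.ω₁ / 2) - L.weierstrassP (L.ω₂ / 2)‖ =
      π ^ 2 * ‖nome (L.ω₂ / L.ω₁)‖ *
        ‖uSeries (nome (L.ω₂ / L.ω₁)) + 16 * nSeries (nome (L.ω₂ / L.ω₁))‖ := by
  have h1 : L.ω₁ ^ 2 * (L.weierstrassP (L.ω₁ / 2) - L.weierstrassP (L.ω₂ / 2)) =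
      π ^ 2 * (1 - 8 * nome (L.ω₂ / L.ω₁) + nome (L.ω₂ / L.ω₁) * dSeries (nome (L.ω₂ / L.ω₁)) +
        16 * nome (L.ω₂ / L.ω₁) * nSeries (nome (L.ω₂ / L.ω₁))) := by
    linear_combination weierstrassP_left_sub_add L h - weierstrassP_right_sub_add L h
  have h2 := congrArg norm h1
  have hq := nome_ne_zero (L.ω₂ / L.ω₁)
  rw [norm_mul, norm_pow] at h2
  rw [h2, uSeries]
  generalize nome (L.ω₂ / L.ω₁) = q at *
  rw [show 1 - 8 * q + q * dSeries q + 16 * q * nSeries q =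
      q * (q⁻¹ - 8 + dSeries q + 16 * nSeries q) by field_simp,
    norm_mul, norm_mul, norm_pow, norm_real, Real.norm_of_nonneg Real.pi_pos.le, mul_assoc]

lemma norm_ω₁_sq_pos : 0 < ‖L.ω₁‖ ^ 2 := by
  have := norm_pos_iff.mpr (ω₁_ne_zero L)
  positivity

lemma pi_sq_mul_norm_nome_pos (τ : ℂ) : 0 < π ^ 2 * ‖nome τ‖ := by
  have := norm_pos_iff.mpr (nome_ne_zero τ)
  have := Real.pi_pos
  positivity

lemma norm_right_lt_norm_left_iff (h : 0 < (L.ω₂ / L.ω₁).im) :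
    ‖L.weierstrassP (L.ω₂ / 2) - L.weierstrassP ((L.ω₁ + L.ω₂) / 2)‖ <
      ‖L.weierstrassP (L.ω₁ / 2) - L.weierstrassP ((L.ω₁ + L.ω₂) / 2)‖ ↔
    16 * ‖nSeries (nome (L.ω₂ / L.ω₁))‖ < ‖uSeries (nome (L.ω₂ / L.ω₁))‖ := by
  rw [← mul_lt_mul_iff_right₀ (norm_ω₁_sq_pos L), norm_left_sub_add L h, norm_right_sub_add L h,
    mul_lt_mul_iff_right₀ (pi_sq_mul_norm_nome_pos _)]

/-- The tangent line of the exponential at 3, with `exp 3 ≥ 20` and `π > 3.14`. -/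
lemma le_norm_nome_inv {τ : ℂ} (hτ : 9 / 10 ≤ τ.im) :
    20 * (314 / 100 * τ.im - 2) ≤ ‖(nome τ)⁻¹‖ := by
  rw [norm_inv, norm_nome, Real.exp_neg, inv_inv]
  have h1 : (20 : ℝ) ≤ Real.exp 3 := by
    have h2 : Real.exp 3 = Real.exp 1 ^ 3 := by
      rw [← Real.exp_nat_mul]
      norm_num
    rw [h2]
    have h3 := Real.exp_one_gt_d9
    calc (20 : ℝ) ≤ (2718 / 1000) ^ 3 := by norm_num
      _ ≤ Real.exp 1 ^ 3 := by gcongr; linarith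
  have h3 : 314 / 100 * τ.im - 2 ≤ Real.exp (π * τ.im - 3) := by
    refine le_trans ?_ (Real.add_one_le_exp _)
    nlinarith [Real.pi_gt_d2]
  have h4 : Real.exp (π * τ.im) = Real.exp 3 * Real.exp (π * τ.im - 3) := by
    rw [← Real.exp_add]
    ring_nf
  rw [h4]
  have h5 : 0 ≤ 314 / 100 * τ.im - 2 := by linarith
  gcongr

lemma norm_nome_le {τ : ℂ} {s : ℝ} (hs : 0 < s) (h : s ≤ ‖(nome τ)⁻¹‖) : ‖nome τ‖ ≤ 1 / s := by
  rw [norm_inv] at h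
  rw [one_div]
  exact (le_inv_comm₀ hs (norm_pos_iff.mpr (nome_ne_zero τ))).mp h

lemma norm_right_lt_norm_left_of_im_ge (h : 11 / 10 ≤ (L.ω₂ / L.ω₁).im) :
    ‖L.weierstrassP (L.ω₂ / 2) - L.weierstrassP ((L.ω₁ + L.ω₂) / 2)‖ <
      ‖L.weierstrassP (L.ω₁ / 2) - L.weierstrassP ((L.ω₁ + L.ω₂) / 2)‖ := by
  rw [norm_right_lt_norm_left_iff L (by linarith)]
  have h1 := le_norm_nome_inv (τ := L.ω₂ / L.ω₁) (by linarith)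
  have h2 : 29 ≤ ‖(nome (L.ω₂ / L.ω₁))⁻¹‖ := by linarith
  have hq : ‖nome (L.ω₂ / L.ω₁)‖ ≤ 1 / 18 :=
    (norm_nome_le (by norm_num) h2).trans (by norm_num)
  generalize nome (L.ω₂ / L.ω₁) = q at *
  have h3 := norm_nSeries_le hq
  have h4 := norm_dSeries_le hq
  have h5 : ‖q⁻¹‖ ≤ ‖uSeries q‖ + 8 + ‖dSeries q‖ := by
    have : q⁻¹ = uSeries q + 8 - dSeries q := by rw [uSeries]; ring
    rw [this]
    refine (norm_sub_le _ _).trans ?_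
    gcongr
    refine (norm_add_le _ _).trans ?_
    rw [Complex.norm_ofNat]
  linarith

lemma re_nome_inv_nonneg {τ : ℂ} (h : |τ.re| ≤ 1 / 2) : 0 ≤ ((nome τ)⁻¹).re := by
  rw [nome, ← exp_neg, exp_re]
  have h1 : (-(π * I * τ)).im = -(π * τ.re) := by simp
  rw [h1, Real.cos_neg]
  have h2 := abs_le.mp h
  have := Real.pi_pos
  refine mul_nonneg (Real.exp_pos _).le (Real.cos_nonneg_of_mem_Icc ⟨?_, ?_⟩)
  · nlinarith
  · nlinarith

/-- Here `uSeries q + 16 * nSeries q` is `q⁻¹ + 8` up to a small error. As `q⁻¹` has nonnegative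
real part, adding 8 does not shorten it, and `|q⁻¹| ≥ 20` exceeds 16 by more than the errors. -/
lemma norm_right_le_norm_left_sub_right (h : 968 / 1000 ≤ (L.ω₂ / L.ω₁).im)
    (hre : |(L.ω₂ / L.ω₁).re| ≤ 1 / 2) :
    ‖L.weierstrassP (L.ω₂ / 2) - L.weierstrassP ((L.ω₁ + L.ω₂) / 2)‖ ≤
      ‖L.weierstrassP (L.ω₁ / 2) - L.weierstrassP (L.ω₂ / 2)‖ := by
  have him : 0 < (L.ω₂ / L.ω₁).im := by linarith
  rw [← mul_le_mul_iff_right₀ (norm_ω₁_sq_pos L), norm_left_sub_right L him,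
    norm_right_sub_add L him, mul_le_mul_iff_right₀ (pi_sq_mul_norm_nome_pos _)]
  have h1 := le_norm_nome_inv (τ := L.ω₂ / L.ω₁) (by linarith)
  have h2 : 20 ≤ ‖(nome (L.ω₂ / L.ω₁))⁻¹‖ := by linarith
  have hq : ‖nome (L.ω₂ / L.ω₁)‖ ≤ 1 / 18 :=
    (norm_nome_le (by norm_num) h2).trans (by norm_num)
  have hr := re_nome_inv_nonneg hre
  generalize nome (L.ω₂ / L.ω₁) = q at *
  have h3 := norm_nSeries_le hq
  have h3' := norm_nSeries_sub_one_le hq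
  have h4 := norm_dSeries_le hq
  have h5 : ‖q⁻¹‖ ≤ ‖q⁻¹ + 8‖ := by
    refine le_of_sq_le_sq ?_ (norm_nonneg _)
    rw [Complex.sq_norm, Complex.sq_norm, normSq_apply, normSq_apply]
    simp only [add_re, add_im, re_ofNat, im_ofNat, add_zero]
    nlinarith
  have h6 : ‖q⁻¹ + 8‖ ≤ ‖uSeries q + 16 * nSeries q‖ + ‖dSeries q‖ + 16 * ‖nSeries q - 1‖ := by
    have : q⁻¹ + 8 = (uSeries q + 16 * nSeries q) - dSeries q - 16 * (nSeries q - 1) := by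
      rw [uSeries]; ring
    rw [this]
    refine (norm_sub_le _ _).trans ?_
    rw [norm_mul, Complex.norm_ofNat]
    gcongr
    exact norm_sub_le _ _
  linarith

lemma im_ge_of_norm_eq_one {τ : ℂ} (h : ‖τ‖ = 1) (hre : |τ.re| ≤ 1 / 3) (him : 0 < τ.im) :
    94 / 100 ≤ τ.im := by
  have h1 : τ.re ^ 2 + τ.im ^ 2 = 1 := by
    have := Complex.sq_norm τ
    rw [h, normSq_apply] at this
    linarith
  have h2 := abs_le.mp hre
  nlinarith

/-- Radial comparison of the nomes of `r τ` and `τ`. -/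
lemma norm_nome_inv_sub_le {τ : ℂ} (h : ‖τ‖ = 1) (him : 94 / 100 ≤ τ.im) {r : ℝ} (hr : 1 < r) :
    ‖nome (r * τ)‖ < ‖nome τ‖ ∧ ‖(nome (r * τ))⁻¹ - (nome τ)⁻¹‖ ≤
      107 / 100 * (‖(nome (r * τ))⁻¹‖ - ‖(nome τ)⁻¹‖) := by
  have hpi := Real.pi_pos
  set z : ℂ := -(π * I * ((r - 1 : ℝ) * τ)) with hz
  have hzre : z.re = π * (r - 1) * τ.im := by simp [hz]; ring
  have hr' : 0 < r - 1 := by linarith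
  have hzre0 : 0 < z.re := by
    rw [hzre]
    have : 0 < τ.im := by linarith
    positivity
  have hzn : ‖z‖ = π * (r - 1) := by
    rw [hz, norm_neg, norm_mul, norm_mul, norm_mul, norm_I, h, norm_real, norm_real,
      Real.norm_of_nonneg hpi.le, Real.norm_of_nonneg hr'.le]
    ring
  have hmul : (nome (r * τ))⁻¹ = (nome τ)⁻¹ * exp z := by
    rw [nome, nome, ← exp_neg, ← exp_neg, ← exp_add, hz]
    congr 1
    push_cast
    ring
  have h1 := norm_exp_sub_one_mul_re_le hzre0
  rw [hzn, hzre] at h1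
  have h2 : ‖exp z - 1‖ * τ.im ≤ Real.exp (π * (r - 1) * τ.im) - 1 := by
    have h3 : 0 < π * (r - 1) := by positivity
    refine le_of_mul_le_mul_left ?_ h3
    linarith
  have h0 := norm_nonneg (exp z - 1)
  -- The ratio `|z| / Re z` is `1 / Im τ`, and `1 / 0.94 < 1.07`.
  have h3 : ‖exp z - 1‖ ≤ 107 / 100 * (Real.exp (π * (r - 1) * τ.im) - 1) := by nlinarith
  constructor
  · rw [norm_nome, norm_nome]
    refine Real.exp_lt_exp.mpr ?_
    have h4 : ((r : ℂ) * τ).im = r * τ.im := by simp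
    rw [h4]
    rw [hzre] at hzre0
    linarith
  · have h5 : (nome (r * τ))⁻¹ - (nome τ)⁻¹ = (nome τ)⁻¹ * (exp z - 1) := by rw [hmul]; ring
    rw [h5, hmul, norm_mul, norm_mul, norm_exp, hzre]
    calc _ ≤ ‖(nome τ)⁻¹‖ * (107 / 100 * (Real.exp (π * (r - 1) * τ.im) - 1)) := by gcongr
      _ = _ := by ring

/-- Projecting `τ` radially to `σ` on the unit circle keeps the bound on the real part. Equality
holds at `σ`, and the quotient strictly increases from `σ` to `τ`. -/
lemma norm_right_lt_norm_left_of_one_lt (him : 0 < (L.ω₂ / L.ω₁).im)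
    (h : 1 < ‖L.ω₂ / L.ω₁‖) (hre : |(L.ω₂ / L.ω₁).re| ≤ 1 / 3) :
    ‖L.weierstrassP (L.ω₂ / 2) - L.weierstrassP ((L.ω₁ + L.ω₂) / 2)‖ <
      ‖L.weierstrassP (L.ω₁ / 2) - L.weierstrassP ((L.ω₁ + L.ω₂) / 2)‖ := by
  rw [norm_right_lt_norm_left_iff L him]
  generalize L.ω₂ / L.ω₁ = τ at *
  obtain ⟨r, hr, σ, hσ, rfl⟩ : ∃ r : ℝ, 1 < r ∧ ∃ σ : ℂ, ‖σ‖ = 1 ∧ τ = r * σ := by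
    have h0 : ‖τ‖ ≠ 0 := by linarith
    refine ⟨‖τ‖, h, τ / ‖τ‖, ?_, ?_⟩
    · rw [norm_div, norm_real, norm_norm, div_self h0]
    · rw [mul_div_cancel₀]
      exact_mod_cast h0
  have hσim : 0 < σ.im := by
    have h1 : ((r : ℂ) * σ).im = r * σ.im := by simp
    rw [h1] at him
    exact pos_of_mul_pos_right him (by linarith)
  have hσre : |σ.re| ≤ 1 / 3 := by
    have h1 : ((r : ℂ) * σ).re = r * σ.re := by simp
    rw [h1, abs_mul, abs_of_pos (by linarith)] at hre
    nlinarith [abs_nonneg σ.re]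
  have hσim' := im_ge_of_norm_eq_one hσ hσre hσim
  have h1 := le_norm_nome_inv (τ := σ) (by linarith)
  have hp : ‖nome σ‖ ≤ 1 / 18 := norm_nome_le (by norm_num) (by linarith)
  obtain ⟨h2, h3⟩ := norm_nome_inv_sub_le hσ hσim' hr
  have key := norm_uSeries_mul_nSeries_lt (nome_ne_zero _) (nome_ne_zero _) hp h2 h3
  have hcirc : ‖uSeries (nome σ)‖ = 16 * ‖nSeries (nome σ)‖ := by
    let M : PeriodPair := ⟨1, σ,
      linearIndependent_of_im_ne_zero one_ne_zero (by simpa using hσim.ne')⟩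
    have hM : M.ω₂ / M.ω₁ = σ := div_one σ
    have h4 := norm_weierstrassP_sub_eq_of_norm_eq_one M (by rw [hM, hσ])
    have h5 := norm_left_sub_add M (by rwa [hM])
    have h6 := norm_right_sub_add M (by rwa [hM])
    rw [h4, h6, hM] at h5
    exact (mul_left_cancel₀ (pi_sq_mul_norm_nome_pos σ).ne' h5).symm
  rw [hcirc] at key
  have hn : 0 < ‖nSeries (nome σ)‖ := by linarith [le_norm_nSeries hp]
  nlinarith

/-- The pair of periods `(ω₁, -ω₂)`. -/
def negRight : PeriodPair where
  ω₁ := L.ω₁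
  ω₂ := -L.ω₂
  indep := by
    have h := L.indep
    rw [LinearIndependent.pair_iff] at h ⊢
    intro s t hst
    have := h s (-t) (by simpa using hst)
    simpa using this

/-- The pair of periods `(ω₂, ω₁)`. -/
def swap : PeriodPair where
  ω₁ := L.ω₂
  ω₂ := L.ω₁
  indep := LinearIndependent.pair_symm_iff.mp L.indep

lemma lattice_negRight : (negRight L).lattice = L.lattice := by
  ext z
  simp only [PeriodPair.mem_lattice, negRight]
  constructor
  · rintro ⟨m, n, rfl⟩
    exact ⟨m, -n, by push_cast; ring⟩
  · rintro ⟨m, n, rfl⟩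
    exact ⟨m, -n, by push_cast; ring⟩

lemma lattice_swap : (swap L).lattice = L.lattice := by
  rw [PeriodPair.lattice, PeriodPair.lattice, Set.pair_comm]
  rfl

lemma weierstrassP_negRight : (negRight L).weierstrassP = L.weierstrassP := by
  rw [← wp_lattice, ← wp_lattice, lattice_negRight]

lemma weierstrassP_swap : (swap L).weierstrassP = L.weierstrassP := by
  rw [← wp_lattice, ← wp_lattice, lattice_swap]

lemma half_values_negRight :
    L.weierstrassP ((negRight L).ω₁ / 2) = L.weierstrassP (L.ω₁ / 2) ∧
    L.weierstrassP ((negRight L).ω₂ / 2) = L.weierstrassP (L.ω₂ / 2) ∧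
    L.weierstrassP (((negRight L).ω₁ + (negRight L).ω₂) / 2) =
      L.weierstrassP ((L.ω₁ + L.ω₂) / 2) := by
  refine ⟨rfl, ?_, ?_⟩
  · simp only [negRight]
    rw [neg_div, L.weierstrassP_neg]
  · simp only [negRight]
    rw [← sub_eq_add_neg, weierstrassP_half_sub]

lemma negRight_div : (negRight L).ω₂ / (negRight L).ω₁ = -(L.ω₂ / L.ω₁) := neg_div _ _

/-- Reduction of the comparison of half period values to the case of positive orientation. -/
lemma of_im_pos {P : ℂ → Prop} (Q : ℂ → ℂ → ℂ → Prop) (hP : ∀ τ, P τ → P (-τ) ∧ τ.im ≠ 0)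
    (H : ∀ L : PeriodPair, 0 < (L.ω₂ / L.ω₁).im → P (L.ω₂ / L.ω₁) →
      Q (L.weierstrassP (L.ω₁ / 2)) (L.weierstrassP (L.ω₂ / 2))
        (L.weierstrassP ((L.ω₁ + L.ω₂) / 2))) (h : P (L.ω₂ / L.ω₁)) :
    Q (L.weierstrassP (L.ω₁ / 2)) (L.weierstrassP (L.ω₂ / 2))
        (L.weierstrassP ((L.ω₁ + L.ω₂) / 2)) := by
  rcases lt_or_gt_of_ne (hP _ h).2 with h1 | h1
  · have h2 := H (negRight L) (by rw [negRight_div]; simpa using h1)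
      (by rw [negRight_div]; exact (hP _ h).1)
    obtain ⟨e1, e2, e3⟩ := half_values_negRight L
    rwa [weierstrassP_negRight, e1, e2, e3] at h2
  · exact H L h1 h

lemma sq_norm_eq_re_im (τ : ℂ) : ‖τ‖ ^ 2 = τ.re ^ 2 + τ.im ^ 2 := by
  rw [Complex.sq_norm, normSq_apply]
  ring

lemma im_ne_zero_of_one_le_norm {τ : ℂ} (h : 1 ≤ ‖τ‖) (hre : |τ.re| ≤ 1 / 3) : τ.im ≠ 0 := by
  intro him
  have h1 := sq_norm_eq_re_im τ
  have h2 := abs_le.mp hre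
  rw [him] at h1
  nlinarith

theorem norm_right_lt_norm_left (h : 1 < ‖L.ω₂ / L.ω₁‖)
    (hre : |(L.ω₂ / L.ω₁).re| ≤ 1 / 3 ∨ 11 / 10 ≤ |(L.ω₂ / L.ω₁).im|) :
    ‖L.weierstrassP (L.ω₂ / 2) - L.weierstrassP ((L.ω₁ + L.ω₂) / 2)‖ <
      ‖L.weierstrassP (L.ω₁ / 2) - L.weierstrassP ((L.ω₁ + L.ω₂) / 2)‖ := by
  refine of_im_pos L (P := fun τ => 1 < ‖τ‖ ∧ (|τ.re| ≤ 1 / 3 ∨ 11 / 10 ≤ |τ.im|))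
    (fun A B C => ‖B - C‖ < ‖A - C‖) ?_ ?_ ⟨h, hre⟩
  · rintro τ ⟨h1, h2⟩
    refine ⟨by simpa only [norm_neg, neg_re, neg_im, abs_neg] using ⟨h1, h2⟩, ?_⟩
    rcases h2 with h2 | h2
    · exact im_ne_zero_of_one_le_norm h1.le h2
    · rintro h3
      rw [h3, abs_zero] at h2
      norm_num at h2
  · rintro L him ⟨h1, h2 | h2⟩
    · exact norm_right_lt_norm_left_of_one_lt L him h1 h2
    · rw [abs_of_pos him] at h2
      exact norm_right_lt_norm_left_of_im_ge L h2

theorem norm_right_le_norm_left (h : 1 ≤ ‖L.ω₂ / L.ω₁‖) (hre : |(L.ω₂ / L.ω₁).re| ≤ 1 / 3) :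
    ‖L.weierstrassP (L.ω₂ / 2) - L.weierstrassP ((L.ω₁ + L.ω₂) / 2)‖ ≤
      ‖L.weierstrassP (L.ω₁ / 2) - L.weierstrassP ((L.ω₁ + L.ω₂) / 2)‖ := by
  rcases h.eq_or_lt with h | h
  · exact (norm_weierstrassP_sub_eq_of_norm_eq_one L h.symm).ge
  · exact (norm_right_lt_norm_left L h (Or.inl hre)).le

theorem norm_right_le_norm_left_sub (h : 1 ≤ ‖L.ω₂ / L.ω₁‖) (hre : |(L.ω₂ / L.ω₁).re| ≤ 1 / 4) :
    ‖L.weierstrassP (L.ω₂ / 2) - L.weierstrassP ((L.ω₁ + L.ω₂) / 2)‖ ≤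
      ‖L.weierstrassP (L.ω₁ / 2) - L.weierstrassP (L.ω₂ / 2)‖ := by
  refine of_im_pos L (P := fun τ => 1 ≤ ‖τ‖ ∧ |τ.re| ≤ 1 / 4)
    (fun A B C => ‖B - C‖ ≤ ‖A - B‖) ?_ ?_ ⟨h, hre⟩
  · rintro τ ⟨h1, h2⟩
    exact ⟨by simpa only [norm_neg, neg_re, neg_im, abs_neg] using ⟨h1, h2⟩, im_ne_zero_of_one_le_norm h1 (by linarith)⟩
  · rintro L him ⟨h1, h2⟩
    -- The threshold 0.968 lies just below `√(1 - 1/16)`.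
    refine norm_right_le_norm_left_sub_right L ?_ (by linarith)
    have h3 := sq_norm_eq_re_im (L.ω₂ / L.ω₁)
    have h4 := abs_le.mp h2
    have h5 : 1 ≤ ‖L.ω₂ / L.ω₁‖ ^ 2 := one_le_pow₀ h1
    nlinarith

variable {Γ : Submodule ℤ ℂ} {ω₁ ω₂ : ℂ}

/-- For a reduced basis with `|ω₂| < 2 |ω₁|`, the ratio `σ = 2 ω₁ / ω₂` is close to the imaginary
axis or far from the real one. -/
lemma IsReducedBasis.re_le_or_le_im (h : IsReducedBasis Γ ω₁ ω₂) :
    |(2 * ω₁ / ω₂).re| ≤ 1 / 3 ∨ 11 / 10 ≤ |(2 * ω₁ / ω₂).im| := by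
  have h1 := h.abs_re_le
  have h2 := h.one_le_norm_div
  have h0 := h.ne_zero
  have h0' := h.right_ne_zero
  have e : 2 * ω₁ / ω₂ = 2 * (ω₂ / ω₁)⁻¹ := by field_simp
  rw [e]
  generalize ω₂ / ω₁ = τ at *
  have hT : 1 ≤ normSq τ := by
    rw [normSq_eq_norm_sq]
    exact one_le_pow₀ h2
  have hT' : normSq τ = τ.re ^ 2 + τ.im ^ 2 := by rw [normSq_eq_norm_sq, sq_norm_eq_re_im]
  have hre : (2 * τ⁻¹).re = 2 * τ.re / normSq τ := by
    simp
    ring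
  have him : (2 * τ⁻¹).im = -(2 * τ.im / normSq τ) := by
    simp
    ring
  rw [hre, him, abs_neg]
  set T := normSq τ
  have hT0 : 0 < T := by linarith
  rcases le_or_gt |2 * τ.re / T| (1 / 3) with hc | hc
  · exact Or.inl hc
  right
  refine abs_le_of_sq_le_sq' ?_ (abs_nonneg _) |>.2
  set u := |2 * τ.re / T| with hu
  have hu1 : u ≤ 1 / T := by
    rw [hu, abs_div, abs_mul, abs_two, abs_of_pos hT0]
    gcongr
    linarith
  have hu2 : 1 / T ≤ 1 := by
    rw [div_le_one hT0]
    exact hT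
  have h3 : (2 * τ.im / T) ^ 2 = 4 * (1 / T) - u ^ 2 := by
    rw [hu, sq_abs]
    field_simp
    linarith
  rw [sq_abs, h3]
  -- From `1/3 < u ≤ 1/T ≤ 1` the left side is at least `4 u - u²`, which exceeds its value `11/9`
  -- at `u = 1/3`, and `11/9 > 1.1²`.
  nlinarith

theorem IsReducedBasis.two_mul_norm_le_iff (h : IsReducedBasis Γ ω₁ ω₂) (M : PeriodPair)
    (h1 : M.ω₁ = 2 * ω₁) (h2 : M.ω₂ = ω₂) :
    2 * ‖ω₁‖ ≤ ‖ω₂‖ ↔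
      ‖M.weierstrassP (M.ω₂ / 2) - M.weierstrassP ((M.ω₁ + M.ω₂) / 2)‖ ≤
        ‖M.weierstrassP (M.ω₁ / 2) - M.weierstrassP (M.ω₂ / 2)‖ ∧
      ‖M.weierstrassP (M.ω₂ / 2) - M.weierstrassP ((M.ω₁ + M.ω₂) / 2)‖ ≤
        ‖M.weierstrassP (M.ω₁ / 2) - M.weierstrassP ((M.ω₁ + M.ω₂) / 2)‖ := by
  have hpos := norm_pos_iff.mpr h.ne_zero
  have hpos' := norm_pos_iff.mpr h.right_ne_zero
  constructor
  · intro hle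
    have hn : 1 ≤ ‖M.ω₂ / M.ω₁‖ := by
      rw [h1, h2, norm_div, norm_mul, Complex.norm_ofNat, one_le_div (by positivity)]
      exact hle
    have hre : |(M.ω₂ / M.ω₁).re| ≤ 1 / 4 := by
      have e : M.ω₂ / M.ω₁ = ((1 / 2 : ℝ) : ℂ) * (ω₂ / ω₁) := by
        rw [h1, h2]
        push_cast
        ring
      rw [e, re_ofReal_mul, abs_mul]
      have := h.abs_re_le
      rw [abs_of_pos (by norm_num)]
      linarith
    exact ⟨norm_right_le_norm_left_sub M hn hre, norm_right_le_norm_left M hn (by linarith)⟩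
  · rintro ⟨-, hle⟩
    by_contra! hlt
    -- Exchanging the periods turns a ratio inside the unit circle into one outside, and reverses
    -- the roles of the two differences.
    have hs : (swap M).ω₂ / (swap M).ω₁ = 2 * ω₁ / ω₂ := by
      simp only [swap, h1, h2]
    have key := norm_right_lt_norm_left (swap M)
      (by
        rw [hs, norm_div, norm_mul, Complex.norm_ofNat, one_lt_div hpos']
        exact hlt)
      (by rw [hs]; exact h.re_le_or_le_im)
    rw [weierstrassP_swap] at key
    simp only [swap, add_comm M.ω₂ M.ω₁] at key
    exact absurd hle (not_le.mpr key)

end Comparison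

end LandenWeierstrass

/-! ### Passage to period pairs and proof of the lemma -/

namespace LandenWeierstrass

theorem IsReducedBasis.lattice_eq {Γ : Submodule ℤ ℂ} {ω₁ ω₂ : ℂ} (h : IsReducedBasis Γ ω₁ ω₂) :
    (PeriodPair.mk ω₁ ω₂ h.linearIndependent).lattice = Γ := by
  ext z
  rw [PeriodPair.mem_lattice, h.mem_iff]
  simp only [eq_comm]

/-- The pair of periods `(2 ω₁, ω₂)`. -/
def doubleLeft (L : PeriodPair) : PeriodPair where
  ω₁ := 2 * L.ω₁
  ω₂ := L.ω₂
  indep := by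
    have h := L.indep
    rw [LinearIndependent.pair_iff] at h ⊢
    intro s t hst
    have := h (2 * s) t (by
      simp only [Complex.real_smul] at hst ⊢
      push_cast
      linear_combination hst)
    simpa using this

end LandenWeierstrass

theorem lemmal41 (Γ : Submodule ℤ ℂ) [DiscreteTopology Γ] [IsZLattice ℝ Γ]
    (e₁ e₂ e₃ : ℂ)
    (hroots : (LandenWeierstrass.cubic Γ).roots = {e₁, e₂, e₃})
    (hord : LandenWeierstrass.ProperlyOrdered e₁ e₂ e₃)
    (ω₁ ω₂ : ℂ) (hred : LandenWeierstrass.IsReducedBasis Γ ω₁ ω₂)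
    (he₁ : e₁ = LandenWeierstrass.wp Γ (ω₁ / 2))
    (he₂ : e₂ = LandenWeierstrass.wp Γ (ω₂ / 2))
    (he₃ : e₃ = LandenWeierstrass.wp Γ ((ω₁ + ω₂) / 2))
    (f₁ f₂ f₃ : ℂ)
    (hf : LandenWeierstrass.landen (e₂, s(e₁, e₃)) = (f₁, s(f₂, f₃)))
    (Γ' : Submodule ℤ ℂ) (hΓ' : Γ' = Submodule.span ℤ {ω₂, 2 * ω₁}) :
    -- (i)
    ((∃ _ : DiscreteTopology Γ', IsZLattice ℝ Γ') ∧
      Γ' ≤ Γ ∧ Γ'.toAddSubgroup.relIndex Γ.toAddSubgroup = 2 ∧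
      (LandenWeierstrass.cubic Γ').roots = {f₁, f₂, f₃} ∧
      f₁ = LandenWeierstrass.wp Γ' ω₁) ∧
    -- (ii)
    ((LandenWeierstrass.IsShortest ((Γ' : Set ℂ) \ {0}) ω₂ ∨
        LandenWeierstrass.IsShortest ((Γ' : Set ℂ) \ {0}) (2 * ω₁)) ∧
      (LandenWeierstrass.IsShortest ((Γ' : Set ℂ) \ {0}) (2 * ω₁) →
        LandenWeierstrass.IsReducedBasis Γ' (2 * ω₁) ω₂) ∧
      (LandenWeierstrass.IsShortest ((Γ' : Set ℂ) \ {0}) ω₂ →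
        LandenWeierstrass.IsReducedBasis Γ' ω₂ (2 * ω₁) ∨
        LandenWeierstrass.IsReducedBasis Γ' ω₂ (2 * ω₁ + ω₂) ∨
        LandenWeierstrass.IsReducedBasis Γ' ω₂ (2 * ω₁ - ω₂))) ∧
    -- (iii)
    (2 * ‖ω₁‖ ≤ ‖ω₂‖ ↔ ‖f₂ - f₃‖ ≤ ‖f₁ - f₂‖ ∧ ‖f₂ - f₃‖ ≤ ‖f₁ - f₃‖) := by
  have hΓ := hred.lattice_eq
  set L : PeriodPair := ⟨ω₁, ω₂, hred.linearIndependent⟩ with hL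
  set M := LandenWeierstrass.doubleLeft L with hM
  have hMΓ : M.lattice = Γ' := by
    rw [hΓ', PeriodPair.lattice, Set.pair_comm]
    rfl
  have hwL : LandenWeierstrass.wp Γ = L.weierstrassP := by
    rw [← hΓ, LandenWeierstrass.wp_lattice]
  have hwM : LandenWeierstrass.wp Γ' = M.weierstrassP := by
    rw [← hMΓ, LandenWeierstrass.wp_lattice]
  rw [he₁, he₂, he₃, hwL] at hf
  have hland := LandenWeierstrass.landen_weierstrassP L M rfl rfl
  rw [hf, Prod.mk.injEq, Sym2.eq_iff] at hland
  obtain ⟨hf₁, hf₂₃⟩ := hland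
  have hroot := LandenWeierstrass.roots_cubic_lattice M
  have hiff := hred.two_mul_norm_le_iff M rfl rfl
  refine ⟨⟨?_, hΓ' ▸ hred.span_double_le, hΓ' ▸ hred.relIndex_span_double, ?_, ?_⟩,
    hΓ' ▸ ⟨hred.isShortest_span_double, hred.isReducedBasis_double_left,
      hred.isReducedBasis_double_right⟩, ?_⟩
  · rw [← hMΓ]
    exact ⟨inferInstance, inferInstance⟩
  · rw [← hMΓ, hroot, ← hf₁]
    rcases hf₂₃ with ⟨h1, h2⟩ | ⟨h1, h2⟩
    · rw [h1, h2]
    · rw [h1, h2]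
      congr 1
      exact Multiset.pair_comm _ _
  · rw [hf₁, hwM]
    congr 1
    change 2 * ω₁ / 2 = ω₁
    ring
  · rw [hiff, ← hf₁]
    -- The Landen map determines `f₂, f₃` only up to order; exchanging them permutes the two
    -- inequalities.
    rcases hf₂₃ with ⟨h1, h2⟩ | ⟨h1, h2⟩
    · rw [h1, h2]
    · rw [h1, h2, norm_sub_rev (M.weierstrassP ((M.ω₁ + M.ω₂) / 2))]
      exact and_comm
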